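/- **Proposition (the net $B\supset O\mapsto\mathcal F_R(O)$ is local and transforms covariantly).** *Setting.* Let $d\ge 2$, $\alpha=(d-1)/2$, and let $i\nu\in(0,\alpha)$ be a complementary series parameter. On $\mathbb R^{d+1}$ with the Minkowski product $P\cdot Q=P_0Q_0-\sum_{k=1}^d P_kQ_k$, let $C_d^+=\{P\mid P\cdot P=0,\ P_0>0\}$ be the future light cone and $SO^\uparrow(d,1)$ the group of linear maps of determinant one preserving the Minkowski product and $C_d^+$. Let $B=\mathbb R^{d-1}\cup\{\infty\}$ (one-point compactification) be identified with the set of rays of $C_d^+$: $\boldsymbol x\in\mathbb R^{d-1}$ corresponds to the ray through $P_{\boldsymbol x}=(\tfrac12(|\boldsymbol x|^2+1),\boldsymbol x,\tfrac12(|\boldsymbol x|^2-1))$ and $\infty$ to the ray through $(1,0,1)$; $\Lambda\cdot O$ denotes the resulting (conformal) action of $SO^\uparrow(d,1)$ on subsets of $B$. *Representation.* $\mathcal K_\nu$ is the Hilbert space completion of the space of smooth functions $\psi:C_d^+\to\mathbb C$ with $\psi(rP)=r^{-\alpha-i\nu}\psi(P)$, $r>0$, with respect to $$(\psi_1,\psi_2)_\nu=(2\pi)^{-\alpha}\frac{\Gamma(\alpha-i\nu)}{\Gamma(i\nu)}\int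 d^{d-1}\boldsymbol x\int d^{d-1}\boldsymbol y\;\overline{\psi_1(P_{\boldsymbol x})}\,(P_{\boldsymbol x}\cdot P_{\boldsymbol y})^{-\alpha+i\nu}\,\psi_2(P_{\boldsymbol y}),$$ with the unitary representation $(V_\nu(\Lambda)\psi)(P)=\psi(\Lambda^{-1}P)$ of $SO^\uparrow(d,1)$ and the conjugation $(\Gamma_\nu\psi)(P)=\overline{\psi(P)}$. Let $F$ be the flip on $\mathcal K_\nu\otimes\mathcal K_\nu$. Let $\theta\mapsto R_\theta$, $\theta\in\mathbb R$, be an invariant Yang–Baxter function: unitaries on $\mathcal K_\nu\otimes\mathcal K_\nu$ such that for all $\theta,\theta'\in\mathbb R$ and $\Lambda\in SO^\uparrow(d,1)$: $R_\theta$ commutes with $V_\nu(\Lambda)\otimes V_\nu(\Lambda)$; $(\Gamma_\nu\otimes\Gamma_\nu)FR_{-\theta}F(\Gamma_\nu\otimes\Gamma_\nu)=R_\theta$; $(R_\theta\otimes1)(1\otimes R_{\theta+\theta'})(R_{\theta'}\otimes1)=(1\otimes R_{\theta'})(R_{\theta+\theta'}\otimes1)(1\otimes R_\theta)$; and $R_{-\theta}=R_\theta^{-1}$.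 *Fock space and fields.* Let $N\in\mathbb N$ and $\theta_1,\dots,\theta_N\in\mathbb R$. On $\mathcal H_1=\mathbb C^N\otimes\mathcal K_\nu$, with orthonormal basis $e_1,\dots,e_N$ of $\mathbb C^N$, let $(\boldsymbol R\Psi)_{jl}=R_{\theta_j-\theta_l}\Psi_{lj}$ on $\mathcal H_1\otimes\mathcal H_1$. Let $\mathcal H_n^R\subset\mathcal H_1^{\otimes n}$ be the subspace of vectors invariant under $\boldsymbol R$ acting on the tensor factors $k,k+1$, for all $k=1,\dots,n-1$, let $P_n$ be the orthogonal projection onto it, and $\mathcal H^R=\bigoplus_{n\ge0}\mathcal H_n^R$. For $\xi\in\mathcal H_1$ let $z^\dagger(\xi)\Psi_n=\sqrt{n+1}\,P_{n+1}(\xi\otimes\Psi_n)$, $\Psi_n\in\mathcal H_n^R$, and $z(\xi)=z^\dagger(\xi)^*$. For real smooth $f$ on $B$ (a real-valued smooth function on $C_d^+$ of homogeneity $-\alpha-i\nu$) put $\phi_{R,j}(f)=z^\dagger(e_j\otimes f)+z(e_j\otimes f)$, an essentially self-adjoint operator on the vectors of finite particle number, and let $e^{i\phi_{R,j}(f)}$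 be the unitary defined by its closure. $V_\nu(\Lambda)$ also denotes the unitary on $\mathcal H^R$ acting by $(1\otimes V_\nu(\Lambda))^{\otimes n}$ on $\mathcal H_n^R$. *Algebras.* For $S\subset B$ let $\mathcal E_R(S)=\{e^{i\phi_{R,j}(f)}\mid j=1,\dots,N,\ f\text{ real smooth on }B,\ \operatorname{supp}f\subset S\}''$, and for open $O\subset B$ with complement $O'=B\setminus O$ let $$\mathcal F_R(O)=\mathcal E_R(O)\cap\mathcal E_R(O')'.$$ *Claim.* (i) Each $\mathcal F_R(O)$, $O\subset B$ open, is a von Neumann algebra on $\mathcal H^R$, and $O_1\subset O_2$ implies $\mathcal F_R(O_1)\subset\mathcal F_R(O_2)$. (ii) (Locality) If $O_1,O_2\subset B$ are open and disjoint, every element of $\mathcal F_R(O_1)$ commutes with every element of $\mathcal F_R(O_2)$. (iii) (Covariance) For all $\Lambda\in SO^\uparrow(d,1)$ and all open $O\subset B$, $$V_\nu(\Lambda)\,\mathcal F_R(O)\,V_\nu(\Lambda)^{-1}=\mathcal F_R(\Lambda\cdot O).$$ -/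

import Mathlib

open scoped TensorProduct ContDiff InnerProductSpace
open MeasureTheory

noncomputable section

namespace DeSitter

/-! ### Minkowski space, the forward light cone, and the group `SO↑(d,1)` -/

/-- Euclidean space `ℝⁿ`; throughout `n = d - 1`. -/
abbrev Euc (n : ℕ) : Type := EuclideanSpace ℝ (Fin n)

/-- Minkowski space `ℝ^{d+1}`, `d = n + 1`, with coordinates `(P₀, (P₁, …, P_{d-1}), P_d)`. -/
abbrev Mink (n : ℕ) : Type := ℝ × Euc n × ℝ

/-- The Minkowski product `P·Q = P₀Q₀ - P₁Q₁ - ⋯ - P_dQ_d`. -/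
def mdot {n : ℕ} (P Q : Mink n) : ℝ := P.1 * Q.1 - ⟪P.2.1, Q.2.1⟫_ℝ - P.2.2 * Q.2.2

/-- The future light cone `C_d⁺ = {P | P·P = 0, P₀ > 0}`. -/
def cone (n : ℕ) : Set (Mink n) := {P | mdot P P = 0 ∧ 0 < P.1}

/-- The proper orthochronous Lorentz group `SO↑(d,1)`: linear maps of Minkowski space that
preserve the Minkowski product, have determinant one and preserve the future light cone. -/
def lorentz (n : ℕ) : Subgroup (Mink n ≃L[ℝ] Mink n) where
  carrier := {Λ | (∀ P Q, mdot (Λ P) (Λ Q) = mdot P Q) ∧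
    LinearMap.det ((Λ : Mink n →L[ℝ] Mink n) : Mink n →ₗ[ℝ] Mink n) = 1 ∧
    ∀ P, Λ P ∈ cone n ↔ P ∈ cone n}
  one_mem' := ⟨fun _ _ => rfl, LinearMap.det_id, fun _ => Iff.rfl⟩
  mul_mem' := by
    rintro A B ⟨hA, dA, cA⟩ ⟨hB, dB, cB⟩
    refine ⟨fun P Q => (hA _ _).trans (hB _ _), ?_, fun P => (cA _).trans (cB _)⟩
    exact (LinearMap.det_comp _ _).trans ((congrArg₂ (· * ·) dA dB).trans (one_mul 1))
  inv_mem' := by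
    rintro A ⟨hA, dA, cA⟩
    have key : ∀ P, A (A⁻¹ P) = P := fun P => A.apply_symm_apply P
    refine ⟨fun P Q => ?_, ?_, fun P => ?_⟩
    · rw [← hA, key, key]
    · have h : ((A : Mink n →L[ℝ] Mink n) : Mink n →ₗ[ℝ] Mink n) ∘ₗ
          (((A⁻¹ : Mink n ≃L[ℝ] Mink n) : Mink n →L[ℝ] Mink n) : Mink n →ₗ[ℝ] Mink n)
          = LinearMap.id := LinearMap.ext fun P => key P
      have h2 := congrArg LinearMap.det h
      rwa [LinearMap.det_comp, dA, one_mul, LinearMap.det_id] at h2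
    · rw [← cA, key]

instance (n : ℕ) : CoeFun (lorentz n) (fun _ => Mink n → Mink n) := ⟨fun Λ => Λ.1⟩

/-- The action of a Lorentz transformation on the light cone. -/
def coneAct {n : ℕ} (Λ : lorentz n) (P : cone n) : cone n := ⟨Λ P, (Λ.2.2.2 P).2 P.2⟩

/-- The dilation `P ↦ r P` of the light cone, `r > 0`. -/
def coneDil {n : ℕ} (r : ℝ) (hr : 0 < r) (P : cone n) : cone n :=
  ⟨r • (P : Mink n), by
    obtain ⟨⟨a, b, c⟩, h1, h2⟩ := P
    refine ⟨?_, mul_pos hr h2⟩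
    simp only [mdot, Prod.smul_mk, smul_eq_mul, inner_smul_left, inner_smul_right,
      conj_trivial] at h1 ⊢
    linear_combination r ^ 2 * h1⟩

/-- The flat section of the light cone,
`x ↦ ((|x|² + 1)/2, x, (|x|² - 1)/2)`. -/
def flat {n : ℕ} (x : Euc n) : cone n :=
  ⟨((‖x‖ ^ 2 + 1) / 2, x, (‖x‖ ^ 2 - 1) / 2), by
    refine ⟨?_, by dsimp only; positivity⟩
    simp only [mdot, real_inner_self_eq_norm_sq]
    ring⟩

/-- The flat orbital base with its point at infinity, `B ≅ ℝ^{d-1} ∪ {∞}`. -/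
abbrev Base (n : ℕ) : Type := OnePoint (Euc n)

/-- The point of `B` determined by the ray through a light-like vector: the ray through
`flat x` goes to `x` and the ray through `(1, 0, 1)` goes to `∞`. -/
def ray {n : ℕ} (P : cone n) : Base n :=
  open Classical in
  if (P : Mink n).1 = (P : Mink n).2.2 then OnePoint.infty
  else (((P : Mink n).1 - (P : Mink n).2.2)⁻¹ • (P : Mink n).2.1 : Euc n)

/-- A light-like vector on the ray belonging to a point of `B`. -/
def rep {n : ℕ} : Base n → cone n
  | none => ⟨(1, 0, 1), by simp [mdot, cone]⟩
  | some x => flat x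

/-- The conformal action of `SO↑(d,1)` on `B ≅ ℝ^{d-1} ∪ {∞}`. -/
def conf {n : ℕ} (Λ : lorentz n) (b : Base n) : Base n := ray (coneAct Λ (rep b))

/-! ### Smooth homogeneous wave functions -/

/-- `α = (d-1)/2`. -/
def alpha (n : ℕ) : ℝ := n / 2

/-- The parameter `s = iν ∈ (0, α)` of a complementary series representation. -/
abbrev Param (n : ℕ) : Type := Set.Ioo (0 : ℝ) (alpha n)

/-- Smooth functions on the light cone: restrictions of functions that are smooth on an open
neighbourhood of the cone. -/
def SmoothOnCone {n : ℕ} (ψ : cone n → ℂ) : Prop :=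
  ∃ (U : Set (Mink n)) (F : Mink n → ℂ), IsOpen U ∧ cone n ⊆ U ∧ ContDiffOn ℝ ∞ F U ∧
    ∀ P : cone n, ψ P = F P

/-- The space of smooth wave functions `ψ` on the light cone which are homogeneous,
`ψ(rP) = r^{-α-iν} ψ(P)` for all `r > 0`; here `s = iν`. -/
def Wave (n : ℕ) (s : Param n) : Submodule ℂ (cone n → ℂ) where
  carrier := {ψ | SmoothOnCone ψ ∧ ∀ (r : ℝ) (hr : 0 < r) (P : cone n),
    ψ (coneDil r hr P) = ((r ^ (-alpha n - (s : ℝ)) : ℝ) : ℂ) * ψ P}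
  zero_mem' := ⟨⟨Set.univ, 0, isOpen_univ, Set.subset_univ _, contDiffOn_const, fun _ => rfl⟩,
    fun r hr P => by simp⟩
  add_mem' := by
    rintro ψ φ ⟨⟨U, F, hU, hc, hF, h⟩, h'⟩ ⟨⟨W, G, hW, hd, hG, g⟩, g'⟩
    refine ⟨⟨U ∩ W, F + G, hU.inter hW, Set.subset_inter hc hd,
      (hF.mono Set.inter_subset_left).add (hG.mono Set.inter_subset_right),
      fun P => by simp [h P, g P]⟩, fun r hr P => ?_⟩
    simp only [Pi.add_apply, h' r hr P, g' r hr P]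
    ring
  smul_mem' := by
    rintro c ψ ⟨⟨U, F, hU, hc, hF, h⟩, h'⟩
    refine ⟨⟨U, c • F, hU, hc, contDiffOn_const.smul hF, fun P => by simp [h P]⟩,
      fun r hr P => ?_⟩
    simp only [Pi.smul_apply, h' r hr P, smul_eq_mul]
    ring

/-- The action of `SO↑(d,1)` on wave functions by pullback, `(Λψ)(P) = ψ(Λ⁻¹P)`. -/
def pull {n : ℕ} {s : Param n} (Λ : lorentz n) : Wave n s ≃ₗ[ℂ] Wave n s :=
  have key : ∀ (M : lorentz n) (ψ : Wave n s), (fun P => (ψ : cone n → ℂ) (coneAct M P)) ∈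
      Wave n s := by
    rintro M ⟨ψ, ⟨U, F, hU, hc, hF, h⟩, h'⟩
    refine ⟨⟨M ⁻¹' U, F ∘ M, hU.preimage M.1.continuous, fun P hP => hc (coneAct M ⟨P, hP⟩).2,
      hF.comp M.1.contDiff.contDiffOn fun _ hx => hx, fun P => h _⟩, fun r hr P => ?_⟩
    rw [← h' r hr]
    exact congrArg ψ (Subtype.ext (M.1.map_smul r (P : Mink n)))
  { toFun := fun ψ => ⟨fun P => (ψ : cone n → ℂ) (coneAct Λ⁻¹ P), key Λ⁻¹ ψ⟩
    invFun := fun ψ => ⟨fun P => (ψ : cone n → ℂ) (coneAct Λ P), key Λ ψ⟩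
    map_add' := fun _ _ => rfl
    map_smul' := fun _ _ => rfl
    left_inv := fun ψ => Subtype.ext <| funext fun P =>
      congrArg (ψ : cone n → ℂ) (Subtype.ext (Λ.1.symm_apply_apply (P : Mink n)))
    right_inv := fun ψ => Subtype.ext <| funext fun P =>
      congrArg (ψ : cone n → ℂ) (Subtype.ext (Λ.1.apply_symm_apply (P : Mink n))) }

/-- Pointwise complex conjugation of wave functions. -/
def conjWave {n : ℕ} {s : Param n} : Wave n s ≃ₛₗ[starRingEnd ℂ] Wave n s :=
  have key : ∀ ψ : Wave n s, (fun P => starRingEnd ℂ ((ψ : cone n → ℂ) P)) ∈ Wave n s := by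
    rintro ⟨ψ, ⟨U, F, hU, hc, hF, h⟩, h'⟩
    refine ⟨⟨U, fun P => starRingEnd ℂ (F P), hU, hc,
      Complex.conjCLE.contDiff.comp_contDiffOn hF, fun P => congrArg _ (h P)⟩, fun r hr P => ?_⟩
    simp only [h' r hr P, map_mul, Complex.conj_ofReal]
  { toFun := fun ψ => ⟨_, key ψ⟩
    invFun := fun ψ => ⟨_, key ψ⟩
    map_add' := fun ψ φ => Subtype.ext <| funext fun P => map_add (starRingEnd ℂ) _ _
    map_smul' := fun c ψ => Subtype.ext <| funext fun P => map_mul (starRingEnd ℂ) _ _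
    left_inv := fun ψ => Subtype.ext <| funext fun P => Complex.conj_conj _
    right_inv := fun ψ => Subtype.ext <| funext fun P => Complex.conj_conj _ }

/-- The constant `(2π)^{-α} Γ(α - iν) / Γ(iν)`. -/
def cst (n : ℕ) (s : ℝ) : ℝ :=
  (2 * Real.pi) ^ (-alpha n) * (Real.Gamma (alpha n - s) / Real.Gamma s)

/-- The intertwining operator
`(I_ν ψ)(P) = (2π)^{-α} Γ(α - iν)/Γ(iν) ∫_B ω(P') (P·P')^{-α+iν} ψ(P')`, in the flat model of
the orbital base, where `ω = d^{d-1}x`. -/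
def inter {n : ℕ} (s : ℝ) (ψ : cone n → ℂ) (P : cone n) : ℂ :=
  (cst n s : ℂ) * ∫ y : Euc n, ((mdot (P : Mink n) (flat y) ^ (-alpha n + s) : ℝ) : ℂ) * ψ (flat y)

/-- The complementary series inner product
`(ψ₁, ψ₂)_ν = ∫_B ω(P) conj (ψ₁(P)) (I_ν ψ₂)(P)`. -/
def form {n : ℕ} (s : ℝ) (ψ φ : cone n → ℂ) : ℂ :=
  ∫ x : Euc n, starRingEnd ℂ (ψ (flat x)) * inter s φ (flat x)

/-! ### The inner product is Lorentz invariant -/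

lemma mdot_flat {n : ℕ} (x y : Euc n) : mdot (flat x : Mink n) (flat y) = ‖x - y‖ ^ 2 / 2 := by
  simp only [mdot, flat]
  rw [@norm_sub_sq_real]
  ring

/-- The coordinate `P₀ - P_d`. -/
def minus {n : ℕ} (P : Mink n) : ℝ := P.1 - P.2.2

lemma minus_flat {n : ℕ} (x : Euc n) : minus (flat x : Mink n) = 1 := by
  simp only [minus, flat]; ring

lemma minus_nonneg {n : ℕ} (P : cone n) : 0 ≤ minus (P : Mink n) := by
  obtain ⟨⟨a, b, c⟩, h1, h2⟩ := P
  have h1' : a * a - ‖b‖ ^ 2 - c * c = 0 := by simpa [mdot] using h1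
  have h2' : 0 < a := h2
  change 0 ≤ a - c
  nlinarith [sq_nonneg ‖b‖]

lemma eq_of_minus_eq_zero {n : ℕ} (P : cone n) (h : minus (P : Mink n) = 0) :
    P = coneDil (P : Mink n).1 P.2.2 (rep OnePoint.infty) := by
  obtain ⟨⟨a, b, c⟩, h1, h2⟩ := P
  have h1' : a * a - ‖b‖ ^ 2 - c * c = 0 := by simpa [mdot] using h1
  have hac : c = a := by
    have : a - c = 0 := h
    linarith
  subst hac
  have hb : b = 0 := by
    have : ‖b‖ ^ 2 = 0 := by linarith
    simpa using this
  subst hb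
  apply Subtype.ext
  simp [coneDil, rep]

lemma eq_of_minus_ne_zero {n : ℕ} (P : cone n) (h : 0 < minus (P : Mink n)) :
    P = coneDil (minus (P : Mink n)) h (flat ((minus (P : Mink n))⁻¹ • (P : Mink n).2.1)) := by
  obtain ⟨⟨a, b, c⟩, h1, h2⟩ := P
  have h1' : a * a - ‖b‖ ^ 2 - c * c = 0 := by simpa [mdot] using h1
  have hne : a - c ≠ 0 := ne_of_gt h
  apply Subtype.ext
  simp only [coneDil, flat, minus]
  refine Prod.ext ?_ (Prod.ext ?_ ?_)
  · simp only [norm_smul, mul_pow, Real.norm_eq_abs, sq_abs, smul_eq_mul, Prod.smul_mk]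
    field_simp
    nlinarith
  · simp [smul_smul, hne]
  · simp only [norm_smul, mul_pow, Real.norm_eq_abs, sq_abs, smul_eq_mul, Prod.smul_mk]
    field_simp
    nlinarith

/-- The conformal map induced by `Λ` in the flat model, away from its pole. -/
def cmap {n : ℕ} (Λ : lorentz n) (x : Euc n) : Euc n :=
  (minus (Λ (flat x)))⁻¹ • (Λ (flat x) : Mink n).2.1

/-- The set where the conformal map is regular. -/
def reg {n : ℕ} (Λ : lorentz n) : Set (Euc n) := {x | 0 < minus (Λ (flat x))}

lemma act_flat {n : ℕ} (Λ : lorentz n) {x : Euc n} (hx : x ∈ reg Λ) :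
    coneAct Λ (flat x) = coneDil (minus (Λ (flat x))) (show 0 < minus (Λ (flat x)) from hx) (flat (cmap Λ x)) :=
  eq_of_minus_ne_zero (coneAct Λ (flat x)) hx

lemma contDiff_flat {n : ℕ} : ContDiff ℝ ∞ (fun x : Euc n => (flat x : Mink n)) := by
  have h : ContDiff ℝ ∞ (fun x : Euc n => ‖x‖ ^ 2) := contDiff_norm_sq ℝ
  exact ((h.add contDiff_const).div_const 2).prodMk
    (contDiff_id.prodMk ((h.sub contDiff_const).div_const 2))

lemma contDiff_minus {n : ℕ} (Λ : lorentz n) :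
    ContDiff ℝ ∞ (fun x : Euc n => minus (Λ (flat x))) := by
  have h : ContDiff ℝ ∞ (fun x : Euc n => Λ (flat x)) := Λ.1.contDiff.comp contDiff_flat
  exact h.fst.sub h.snd.snd

lemma isOpen_reg {n : ℕ} (Λ : lorentz n) : IsOpen (reg Λ) :=
  isOpen_lt continuous_const (contDiff_minus Λ).continuous

lemma differentiableAt_cmap {n : ℕ} (Λ : lorentz n) {x : Euc n} (hx : x ∈ reg Λ) :
    DifferentiableAt ℝ (cmap Λ) x := by
  have h : ContDiff ℝ ∞ (fun x : Euc n => Λ (flat x)) := Λ.1.contDiff.comp contDiff_flat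
  have hx' : minus (Λ (flat x)) ≠ 0 := ne_of_gt hx
  exact (((contDiff_minus Λ).differentiable (by simp)).differentiableAt.inv hx').smul
    ((h.snd.fst).differentiable (by simp)).differentiableAt

lemma norm_cmap_sub {n : ℕ} (Λ : lorentz n) {x y : Euc n} (hx : x ∈ reg Λ) (hy : y ∈ reg Λ) :
    minus (Λ (flat x)) * minus (Λ (flat y)) * ‖cmap Λ x - cmap Λ y‖ ^ 2 = ‖x - y‖ ^ 2 := by
  have h1 := Λ.2.1 (flat x) (flat y)
  have e1 : (Λ (flat x) : Mink n) = minus (Λ (flat x)) • (flat (cmap Λ x) : Mink n) :=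
    congrArg Subtype.val (act_flat Λ hx)
  have e2 : (Λ (flat y) : Mink n) = minus (Λ (flat y)) • (flat (cmap Λ y) : Mink n) :=
    congrArg Subtype.val (act_flat Λ hy)
  rw [mdot_flat] at h1
  have h2 : mdot (Λ (flat x)) (Λ (flat y)) = minus (Λ (flat x)) * minus (Λ (flat y)) *
      mdot (flat (cmap Λ x) : Mink n) (flat (cmap Λ y)) := by
    conv_lhs => rw [e1, e2]
    simp only [mdot, Prod.smul_fst, Prod.smul_snd, smul_eq_mul, inner_smul_left, inner_smul_right,
      conj_trivial]
    ring
  rw [mdot_flat] at h2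
  have h3 : mdot (Λ (flat x)) (Λ (flat y)) = ‖x - y‖ ^ 2 / 2 := h1
  linarith

lemma norm_fderiv_cmap {n : ℕ} (Λ : lorentz n) {x : Euc n} (hx : x ∈ reg Λ) (v : Euc n) :
    minus (Λ (flat x)) * ‖fderiv ℝ (cmap Λ) x v‖ = ‖v‖ := by
  have hd := (differentiableAt_cmap Λ hx).hasFDerivAt.hasLineDerivAt v
  have ht := (hasDerivAt_iff_tendsto_slope_zero.1 hd)
  have hx0 : 0 < minus (Λ (flat x)) := hx
  simp only [zero_add, zero_smul, add_zero] at ht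
  set a : Euc n → ℝ := fun y => minus (Λ (flat y)) with ha
  have hcont : Continuous a := (contDiff_minus Λ).continuous
  have hline : Filter.Tendsto (fun t : ℝ => x + t • v) (nhdsWithin 0 {0}ᶜ) (nhds x) := by
    have : Continuous fun t : ℝ => x + t • v := by fun_prop
    have h := (this.tendsto 0).mono_left (nhdsWithin_le_nhds (s := {0}ᶜ))
    simpa using h
  have h1 : Filter.Tendsto (fun t : ℝ => a x * a (x + t • v) *
      ‖t⁻¹ • (cmap Λ (x + t • v) - cmap Λ x)‖ ^ 2) (nhdsWithin 0 {0}ᶜ)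
      (nhds (a x * a x * ‖fderiv ℝ (cmap Λ) x v‖ ^ 2)) :=
    (tendsto_const_nhds.mul ((hcont.tendsto x).comp hline)).mul ((ht.norm).pow 2)
  have h2 : Filter.Tendsto (fun t : ℝ => a x * a (x + t • v) *
      ‖t⁻¹ • (cmap Λ (x + t • v) - cmap Λ x)‖ ^ 2) (nhdsWithin 0 {0}ᶜ) (nhds (‖v‖ ^ 2)) := by
    refine tendsto_const_nhds.congr' ?_
    have hev : ∀ᶠ t in nhdsWithin (0 : ℝ) {0}ᶜ, x + t • v ∈ reg Λ :=
      hline.eventually ((isOpen_reg Λ).mem_nhds hx)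
    filter_upwards [hev, self_mem_nhdsWithin] with t ht ht0
    have h3 := norm_cmap_sub Λ hx ht
    rw [norm_smul, mul_pow, norm_sub_rev (cmap Λ (x + t • v))]
    have h4 : ‖x - (x + t • v)‖ ^ 2 = t ^ 2 * ‖v‖ ^ 2 := by
      rw [sub_add_cancel_left, norm_neg, norm_smul, mul_pow, Real.norm_eq_abs, sq_abs]
    rw [h4] at h3
    have ht0' : t ≠ 0 := ht0
    rw [Real.norm_eq_abs, sq_abs]
    field_simp
    linarith
  have h3 := tendsto_nhds_unique h1 h2
  have h4 : (a x * ‖fderiv ℝ (cmap Λ) x v‖) ^ 2 = ‖v‖ ^ 2 := by rw [← h3]; ring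
  exact (sq_eq_sq₀ (mul_nonneg hx0.le (norm_nonneg _)) (norm_nonneg _)).1 h4

lemma abs_det_of_norm {n : ℕ} (L : Euc n →L[ℝ] Euc n) (h : ∀ v, ‖L v‖ = ‖v‖) :
    |L.det| = 1 := by
  let e : Euc n →ₗᵢ[ℝ] Euc n := ⟨L, h⟩
  let e' : Euc n ≃ₗᵢ[ℝ] Euc n := e.toLinearIsometryEquiv rfl
  have h1 := Measure.addHaar_image_continuousLinearMap (μ := (volume : Measure (Euc n))) L
    (Metric.ball 0 1)
  have h2 : L '' Metric.ball 0 1 = Metric.ball 0 1 := by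
    have h := e'.image_ball 0 1
    rw [map_zero] at h
    exact h
  rw [h2] at h1
  have h3 : ENNReal.ofReal |L.det| = 1 := by
    have hpos := (Metric.measure_ball_pos (volume : Measure (Euc n)) 0 one_pos).ne'
    have hfin := (measure_ball_lt_top (μ := (volume : Measure (Euc n))) (x := 0) (r := 1)).ne
    have : ENNReal.ofReal |L.det| * volume (Metric.ball (0 : Euc n) 1)
      = 1 * volume (Metric.ball (0 : Euc n) 1) := by rw [one_mul]; exact h1.symm
    exact (ENNReal.mul_left_inj hpos hfin).1 this
  simpa using h3

lemma abs_det_cmap {n : ℕ} (Λ : lorentz n) {x : Euc n} (hx : x ∈ reg Λ) :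
    |(fderiv ℝ (cmap Λ) x).det| = (minus (Λ (flat x)) ^ n)⁻¹ := by
  have hx0 : 0 < minus (Λ (flat x)) := hx
  have h := abs_det_of_norm (minus (Λ (flat x)) • fderiv ℝ (cmap Λ) x) (fun v => by
    rw [smul_apply, norm_smul, Real.norm_of_nonneg hx0.le,
      norm_fderiv_cmap Λ hx])
  have h2 : (minus (Λ (flat x)) • fderiv ℝ (cmap Λ) x).det
      = minus (Λ (flat x)) ^ n * (fderiv ℝ (cmap Λ) x).det := by
    simp [ContinuousLinearMap.det]
  rw [h2, abs_mul, abs_of_pos (pow_pos hx0 n)] at h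
  exact eq_inv_of_mul_eq_one_right h

lemma coneAct_inv {n : ℕ} (Λ : lorentz n) (P : cone n) : coneAct Λ⁻¹ (coneAct Λ P) = P :=
  Subtype.ext (Λ.1.symm_apply_apply (P : Mink n))

lemma coneAct_inv' {n : ℕ} (Λ : lorentz n) (P : cone n) : coneAct Λ (coneAct Λ⁻¹ P) = P :=
  Subtype.ext (Λ.1.apply_symm_apply (P : Mink n))

lemma coneAct_dil {n : ℕ} (Λ : lorentz n) (r : ℝ) (hr : 0 < r) (P : cone n) :
    coneAct Λ (coneDil r hr P) = coneDil r hr (coneAct Λ P) :=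
  Subtype.ext (Λ.1.map_smul r (P : Mink n))

lemma dil_flat_inj {n : ℕ} {r t : ℝ} (hr : 0 < r) (ht : 0 < t) {x y : Euc n}
    (h : coneDil r hr (flat x) = coneDil t ht (flat y)) : x = y := by
  have h' := congrArg Subtype.val h
  simp only [coneDil] at h'
  have h1 : r = t := by
    have := congrArg minus h'
    simp only [minus, flat, Prod.smul_fst, Prod.smul_snd, smul_eq_mul] at this
    linarith
  subst h1
  have h2 : r • x = r • y := congrArg (fun P : Mink n => P.2.1) h'
  exact smul_right_injective _ hr.ne' h2

lemma volume_compl_reg {n : ℕ} (hn : 0 < n) (Λ : lorentz n) : volume (reg Λ)ᶜ = 0 := by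
  have : Nonempty (Fin n) := ⟨⟨0, hn⟩⟩
  have : Nontrivial (Euc n) := inferInstance
  refine Set.Subsingleton.measure_zero ?_ _
  intro x hx y hy
  have aux : ∀ z : Euc n, z ∈ (reg Λ)ᶜ → ∃ r, ∃ hr : 0 < r,
      flat z = coneDil r hr (coneAct Λ⁻¹ (rep OnePoint.infty)) := by
    intro z hz
    have hz0 : minus (Λ (flat z)) = 0 :=
      le_antisymm (not_lt.1 hz) (minus_nonneg (coneAct Λ (flat z)))
    have h := eq_of_minus_eq_zero (coneAct Λ (flat z)) hz0
    refine ⟨_, (coneAct Λ (flat z)).2.2, ?_⟩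
    rw [← coneAct_dil, ← h, coneAct_inv]
  obtain ⟨r, hr, h1⟩ := aux x hx
  obtain ⟨t, ht, h2⟩ := aux y hy
  refine dil_flat_inj (r := t) (t := r) ht hr ?_
  rw [h1, h2]
  apply Subtype.ext
  simp only [coneDil, smul_smul, mul_comm]

lemma cmap_inv {n : ℕ} (Λ : lorentz n) {x : Euc n} (hx : x ∈ reg Λ) :
    cmap Λ x ∈ reg Λ⁻¹ ∧ cmap Λ⁻¹ (cmap Λ x) = x := by
  have h := congrArg (coneAct Λ⁻¹) (act_flat Λ hx)
  rw [coneAct_inv, coneAct_dil] at h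
  have hx0 : 0 < minus (Λ (flat x)) := hx
  have hm : minus (Λ (flat x)) * minus (Λ⁻¹ (flat (cmap Λ x))) = 1 := by
    have := congrArg (fun P : cone n => minus (P : Mink n)) h
    simp only [minus_flat, coneDil, coneAct] at this
    rw [this]
    simp only [minus, Prod.smul_fst, Prod.smul_snd, smul_eq_mul]
    ring
  have hreg : cmap Λ x ∈ reg Λ⁻¹ := by
    refine (pos_iff_pos_of_mul_pos ?_).1 hx0
    rw [hm]; exact one_pos
  refine ⟨hreg, ?_⟩
  rw [act_flat Λ⁻¹ hreg] at h
  have h2 : coneDil 1 one_pos (flat x) = coneDil (minus (Λ (flat x)) *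
      minus (Λ⁻¹ (flat (cmap Λ x)))) (mul_pos hx0 hreg) (flat (cmap Λ⁻¹ (cmap Λ x))) := by
    apply Subtype.ext
    have := congrArg Subtype.val h
    simp only [coneDil, smul_smul, one_smul] at this ⊢
    exact this
  exact (dil_flat_inj _ _ h2).symm

/-- The integral of a function of degree `-(d-1)` over the flat section is Lorentz invariant. -/
lemma integral_coneAct {n : ℕ} (hn : 0 < n) (Λ : lorentz n) (h : cone n → ℂ)
    (hh : ∀ (r : ℝ) (hr : 0 < r) (P : cone n), h (coneDil r hr P) = ((r ^ n)⁻¹ : ℝ) * h P) :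
    ∫ x : Euc n, h (coneAct Λ (flat x)) = ∫ x : Euc n, h (flat x) := by
  have himg : cmap Λ '' reg Λ = reg Λ⁻¹ := by
    ext y
    constructor
    · rintro ⟨x, hx, rfl⟩
      exact (cmap_inv Λ hx).1
    · intro hy
      have := cmap_inv Λ⁻¹ hy
      rw [inv_inv] at this
      exact ⟨_, this.1, this.2⟩
  have hinj : Set.InjOn (cmap Λ) (reg Λ) := by
    intro x hx y hy hxy
    rw [← (cmap_inv Λ hx).2, hxy, (cmap_inv Λ hy).2]
  have hmain := integral_image_eq_integral_abs_det_fderiv_smul (volume : Measure (Euc n))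
    (isOpen_reg Λ).measurableSet
    (fun x hx => ((differentiableAt_cmap Λ hx).hasFDerivAt).hasFDerivWithinAt) hinj
    (fun x => h (flat x))
  rw [himg] at hmain
  have hae : ∀ M : lorentz n, (volume : Measure (Euc n)).restrict (reg M) = volume := by
    intro M
    rw [Measure.restrict_eq_self_of_ae_mem]
    exact mem_ae_iff.2 (volume_compl_reg hn M)
  rw [hae] at hmain
  rw [hmain, ← hae Λ, hae Λ]
  conv_lhs => rw [← hae Λ]
  refine setIntegral_congr_fun (isOpen_reg Λ).measurableSet fun x hx => ?_
  rw [act_flat Λ hx, hh, abs_det_cmap Λ hx, Complex.real_smul]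


lemma mdot_coneAct {n : ℕ} (Λ : lorentz n) (P Q : cone n) :
    mdot (coneAct Λ P : Mink n) (coneAct Λ Q) = mdot (P : Mink n) Q := Λ.2.1 P Q

lemma mdot_dil_left {n : ℕ} (r : ℝ) (hr : 0 < r) (P Q : cone n) :
    mdot (coneDil r hr P : Mink n) Q = r * mdot (P : Mink n) Q := by
  simp only [mdot, coneDil, Prod.smul_fst, Prod.smul_snd, smul_eq_mul, inner_smul_left,
    conj_trivial]
  ring

lemma mdot_dil_right {n : ℕ} (r : ℝ) (hr : 0 < r) (P Q : cone n) :
    mdot (P : Mink n) (coneDil r hr Q) = r * mdot (P : Mink n) Q := by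
  simp only [mdot, coneDil, Prod.smul_fst, Prod.smul_snd, smul_eq_mul, inner_smul_right]
  ring

lemma mdot_nonneg {n : ℕ} (P Q : cone n) : 0 ≤ mdot (P : Mink n) Q := by
  obtain ⟨⟨a, b, c⟩, h1, h2⟩ := P
  obtain ⟨⟨a', b', c'⟩, h1', h2'⟩ := Q
  have e1 : a * a - ‖b‖ ^ 2 - c * c = 0 := by simpa [mdot] using h1
  have e2 : a' * a' - ‖b'‖ ^ 2 - c' * c' = 0 := by simpa [mdot] using h1'
  have p1 : 0 < a := h2
  have p2 : 0 < a' := h2'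
  have h3 := real_inner_le_norm b b'
  change 0 ≤ a * a' - ⟪b, b'⟫_ℝ - c * c'
  have h4 : ‖b‖ * ‖b'‖ + c * c' ≤ a * a' := by
    refine abs_le_of_sq_le_sq' ?_ (mul_pos p1 p2).le |>.2
    have : (a * a') ^ 2 = (‖b‖ ^ 2 + c * c) * (‖b'‖ ^ 2 + c' * c') := by
      rw [mul_pow, pow_two a, pow_two a']
      rw [show a * a = ‖b‖ ^ 2 + c * c by linarith, show a' * a' = ‖b'‖ ^ 2 + c' * c' by linarith]
    rw [this]
    nlinarith [sq_nonneg (‖b‖ * c' - ‖b'‖ * c)]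
  linarith

lemma rpow_deg {n : ℕ} {r : ℝ} (hr : 0 < r) (s : ℝ) :
    r ^ (-alpha n + s) * r ^ (-alpha n - s) = (r ^ n)⁻¹ := by
  rw [← Real.rpow_add hr, ← Real.rpow_natCast, ← Real.rpow_neg hr.le]
  congr 1
  simp only [alpha]; ring

lemma inter_coneAct {n : ℕ} (hn : 0 < n) {s : Param n} (Λ : lorentz n) (ψ : Wave n s)
    (P : cone n) : inter s (pull Λ ψ : Wave n s) P = inter s ψ (coneAct Λ⁻¹ P) := by
  simp only [inter]
  congr 1
  have h := integral_coneAct hn Λ⁻¹ (fun Q => ((mdot (coneAct Λ⁻¹ P : Mink n) Q ^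
    (-alpha n + (s : ℝ)) : ℝ) : ℂ) * (ψ : cone n → ℂ) Q) (fun r hr Q => by
      rw [mdot_dil_right, ψ.2.2 r hr, Real.mul_rpow hr.le (mdot_nonneg _ _), ← rpow_deg hr (s : ℝ)]
      push_cast
      ring)
  rw [← h]
  simp only [mdot_coneAct]
  rfl

lemma inter_dil {n : ℕ} {s : ℝ} (ψ : cone n → ℂ) (r : ℝ) (hr : 0 < r)
    (P : cone n) : inter s ψ (coneDil r hr P) = ((r ^ (-alpha n + s) : ℝ) : ℂ) * inter s ψ P := by
  simp only [inter]
  rw [mul_left_comm, ← integral_const_mul (((r ^ (-alpha n + s) : ℝ) : ℂ))]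
  congr 2
  funext y
  rw [mdot_dil_left, Real.mul_rpow hr.le (mdot_nonneg _ _)]
  push_cast
  ring

lemma Param.pos_dim {n : ℕ} (s : Param n) : 0 < n := by
  rcases Nat.eq_zero_or_pos n with h | h
  · exfalso
    have h1 := s.2.1.trans s.2.2
    simp [alpha, h] at h1
  · exact h

lemma form_pull {n : ℕ} {s : Param n} (Λ : lorentz n) (ψ φ : Wave n s) :
    form (s : ℝ) (pull Λ ψ : Wave n s).1 (pull Λ φ : Wave n s).1 = form (s : ℝ) ψ.1 φ.1 := by
  simp only [form, inter_coneAct s.pos_dim]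
  have h := integral_coneAct s.pos_dim Λ⁻¹ (fun Q => starRingEnd ℂ ((ψ : cone n → ℂ) Q) *
    inter (s : ℝ) φ Q) (fun r hr Q => by
      rw [inter_dil, ψ.2.2 r hr, ← rpow_deg hr (s : ℝ), map_mul, Complex.conj_ofReal]
      push_cast
      ring)
  rw [← h]
  rfl

/-! ### Integrability and positivity of the inner product -/

lemma SmoothOnCone.continuous {n : ℕ} {ψ : cone n → ℂ} (h : SmoothOnCone ψ) : Continuous ψ := by
  obtain ⟨U, F, hU, hc, hF, h⟩ := h
  have h1 : Continuous (fun P : cone n => F P) :=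
    continuousOn_iff_continuous_domRestrict.1 (hF.continuousOn.mono hc)
  exact (funext h : ψ = _) ▸ h1

lemma continuous_flat {n : ℕ} : Continuous (flat : Euc n → cone n) :=
  contDiff_flat.continuous.subtype_mk _

lemma wave_bound {n : ℕ} {s : Param n} (ψ : Wave n s) :
    ∃ C : ℝ, ∀ x : Euc n, ‖(ψ : cone n → ℂ) (flat x)‖ ≤
      C * (1 + ‖x‖ ^ 2) ^ (-alpha n - (s : ℝ)) := by
  have hcont := ψ.2.1.continuous
  let K : Set (cone n) := {P | (P : Mink n).1 = 1}
  have hK : IsCompact K := by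
    rw [Subtype.isCompact_iff]
    refine Metric.isCompact_of_isClosed_isBounded ?_ ?_
    · have : (Subtype.val '' K : Set (Mink n)) = {P | mdot P P = 0 ∧ P.1 = 1} := by
        ext P
        constructor
        · rintro ⟨Q, hQ, rfl⟩
          exact ⟨Q.2.1, hQ⟩
        · rintro ⟨h1, h2⟩
          exact ⟨⟨P, h1, h2 ▸ one_pos⟩, h2, rfl⟩
      rw [this]
      refine IsClosed.inter (isClosed_eq ?_ continuous_const) (isClosed_eq continuous_fst
        continuous_const)
      unfold mdot
      fun_prop
    · refine (Metric.isBounded_closedBall (x := (0 : Mink n)) (r := 1)).subset ?_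
      rintro _ ⟨⟨⟨a, b, c⟩, h1, h2⟩, h3, rfl⟩
      have e1 : a * a - ‖b‖ ^ 2 - c * c = 0 := by simpa [mdot] using h1
      have e2 : a = 1 := h3
      subst e2
      rw [mem_closedBall_zero_iff]
      simp only [Prod.norm_mk, norm_one, sup_le_iff, le_refl, true_and, Real.norm_eq_abs]
      exact ⟨by nlinarith [sq_nonneg c, norm_nonneg b],
        abs_le_one_iff_mul_self_le_one.2 (by nlinarith [sq_nonneg ‖b‖])⟩
  obtain ⟨C, hC⟩ := hK.exists_bound_of_continuousOn hcont.continuousOn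
  refine ⟨C * (1 / 2) ^ (-alpha n - (s : ℝ)), fun x => ?_⟩
  have hr : 0 < (1 + ‖x‖ ^ 2) * (1 / 2) := by positivity
  have h1 : flat x = coneDil _ hr (coneDil _ (inv_pos.2 hr) (flat x)) := by
    apply Subtype.ext
    simp only [coneDil, smul_smul]
    rw [mul_inv_cancel₀ hr.ne', one_smul]
  rw [h1, ψ.2.2 _ hr, norm_mul, Complex.norm_real, Real.norm_of_nonneg (by positivity),
    Real.mul_rpow (by positivity) (by norm_num)]
  have h2 := hC (coneDil _ (inv_pos.2 hr) (flat x)) (by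
    change ((1 + ‖x‖ ^ 2) * (1 / 2))⁻¹ * ((‖x‖ ^ 2 + 1) / 2) = 1
    field_simp
    ring)
  calc _ ≤ (1 + ‖x‖ ^ 2) ^ (-alpha n - (s : ℝ)) * (1 / 2) ^ (-alpha n - (s : ℝ)) * C := by gcongr
    _ = _ := by ring

/-- The kernel of the inner product in the flat model. -/
def ker {n : ℕ} (s : ℝ) (x y : Euc n) : ℝ := (‖x - y‖ ^ 2 / 2) ^ (-alpha n + s)

lemma ker_nonneg {n : ℕ} (s : ℝ) (x y : Euc n) : 0 ≤ ker s x y := by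
  unfold ker; positivity

lemma measurable_ker {n : ℕ} (s : ℝ) :
    Measurable (fun p : Euc n × Euc n => ker s p.1 p.2) := by
  unfold ker
  fun_prop

lemma integrable_near {n : ℕ} (s : Param n) :
    Integrable (fun z : Euc n => (Metric.ball (0 : Euc n) 1).indicator
      (fun z => (‖z‖ ^ 2 / 2) ^ (-alpha n + (s : ℝ))) z) := by
  have hn := s.pos_dim
  have : Nonempty (Fin n) := ⟨⟨0, hn⟩⟩
  have : Nontrivial (Euc n) := inferInstance
  have h1 : (fun z : Euc n => (Metric.ball (0 : Euc n) 1).indicator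
      (fun z => (‖z‖ ^ 2 / 2) ^ (-alpha n + (s : ℝ))) z) = fun z : Euc n =>
        (fun r : ℝ => (Set.Iio 1).indicator (fun r => (r ^ 2 / 2) ^ (-alpha n + (s : ℝ))) r) ‖z‖ := by
    funext z
    by_cases hz : ‖z‖ < 1 <;> simp [Set.indicator, hz]
  rw [h1, integrable_fun_norm_addHaar]
  rw [show Module.finrank ℝ (Euc n) = n by simp]
  have h2 : IntegrableOn (fun r : ℝ => (1 / 2 : ℝ) ^ (-alpha n + (s : ℝ)) *
      r ^ (2 * (s : ℝ) - 1)) (Set.Ioo 0 1) := by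
    refine Integrable.const_mul ?_ _
    have := (intervalIntegral.integrableOn_Ioo_rpow_iff (s := 2 * (s : ℝ) - 1) one_pos).2
      (by linarith [s.2.1])
    exact this
  have h3 : IntegrableOn ((Set.Ioo (0 : ℝ) 1).indicator (fun r : ℝ =>
      (1 / 2 : ℝ) ^ (-alpha n + (s : ℝ)) * r ^ (2 * (s : ℝ) - 1))) (Set.Ioi 0) :=
    (h2.integrable_indicator measurableSet_Ioo).integrableOn
  refine h3.congr_fun ?_ measurableSet_Ioi
  intro r hr
  have hr0 : 0 < r := hr
  by_cases h : r < 1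
  · simp only [Set.indicator, Set.mem_Ioo, hr0, h, and_self, if_true, Set.mem_Iio, smul_eq_mul]
    rw [show r ^ 2 / 2 = (1 / 2) * r ^ 2 by ring, Real.mul_rpow (by norm_num) (by positivity)]
    rw [← Real.rpow_natCast r 2, ← Real.rpow_mul hr0.le, ← Real.rpow_natCast r (n - 1)]
    rw [mul_left_comm, ← Real.rpow_add hr0]
    congr 2
    rw [Nat.cast_sub (by omega)]
    simp only [alpha]
    push_cast
    ring
  · simp [Set.indicator, h]

lemma integrable_weight {n : ℕ} (s : Param n) :
    Integrable (fun x : Euc n => (1 + ‖x‖ ^ 2) ^ (-alpha n - (s : ℝ))) := by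
  have h := integrable_rpow_neg_one_add_norm_sq (E := Euc n) (μ := volume)
    (r := n + 2 * (s : ℝ)) (by simp [s.2.1])
  convert! h using 3
  simp only [alpha]
  ring

lemma integrable_ker {n : ℕ} (s : Param n) :
    Integrable (fun p : Euc n × Euc n => ker (s : ℝ) p.1 p.2 *
      ((1 + ‖p.1‖ ^ 2) ^ (-alpha n - (s : ℝ)) * (1 + ‖p.2‖ ^ 2) ^ (-alpha n - (s : ℝ))))
      (volume.prod volume) := by
  set w : Euc n → ℝ := fun x => (1 + ‖x‖ ^ 2) ^ (-alpha n - (s : ℝ)) with hw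
  set k : Euc n → ℝ := (Metric.ball (0 : Euc n) 1).indicator
      (fun z => (‖z‖ ^ 2 / 2) ^ (-alpha n + (s : ℝ))) with hk
  have hw0 : ∀ x, 0 ≤ w x := fun x => by positivity
  have hα : 0 < alpha n := s.2.1.trans s.2.2
  have hw1 : ∀ x, w x ≤ 1 := fun x =>
    Real.rpow_le_one_of_one_le_of_nonpos (by nlinarith [sq_nonneg ‖x‖]) (by linarith [s.2.1])
  have hwi : Integrable w := integrable_weight s
  have hki : Integrable k := integrable_near s
  have h1 : Integrable (fun p : Euc n × Euc n => w p.2 * k (p.1 - p.2)) (volume.prod volume) := by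
    have := Integrable.convolution_integrand (ContinuousLinearMap.mul ℝ ℝ) hwi hki
    exact this
  have h2 : Integrable (fun p : Euc n × Euc n => w p.1 * w p.2) (volume.prod volume) :=
    hwi.mul_prod hwi
  set M : ℝ := (1 / 2 : ℝ) ^ (-alpha n + (s : ℝ)) with hM
  have hM0 : 0 ≤ M := by positivity
  refine (h1.add (h2.const_mul M)).mono' ?_ ?_
  · refine ((measurable_ker _).mul ?_).aestronglyMeasurable
    fun_prop
  · refine Filter.Eventually.of_forall fun p => ?_
    have hkp := ker_nonneg (s : ℝ) p.1 p.2
    have hww := mul_nonneg (hw0 p.1) (hw0 p.2)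
    rw [Real.norm_of_nonneg (mul_nonneg hkp hww)]
    simp only [Pi.add_apply]
    change ker (s : ℝ) p.1 p.2 * (w p.1 * w p.2) ≤ w p.2 * k (p.1 - p.2) + M * (w p.1 * w p.2)
    have hkk : 0 ≤ k (p.1 - p.2) := by
      simp only [hk]
      exact Set.indicator_nonneg (fun z _ => by positivity) _
    by_cases h : ‖p.1 - p.2‖ < 1
    · have e : k (p.1 - p.2) = ker (s : ℝ) p.1 p.2 := by
        simp [hk, ker, h]
      rw [e]
      have : ker (s : ℝ) p.1 p.2 * (w p.1 * w p.2) ≤ w p.2 * ker (s : ℝ) p.1 p.2 := by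
        calc _ ≤ ker (s : ℝ) p.1 p.2 * (1 * w p.2) := by
              gcongr
              exact hw1 _
          _ = _ := by ring
      have := mul_nonneg hM0 hww
      linarith
    · have : ker (s : ℝ) p.1 p.2 ≤ M := by
        refine Real.rpow_le_rpow_of_nonpos (by norm_num) ?_ (by linarith [s.2.2])
        have := not_lt.1 h
        nlinarith
      have h5 : ker (s : ℝ) p.1 p.2 * (w p.1 * w p.2) ≤ M * (w p.1 * w p.2) := by gcongr
      have h6 := mul_nonneg (hw0 p.2) hkk
      linarith

/-- The integrand of the inner product, as a function on the product. -/
def integrand {n : ℕ} (s : ℝ) (ψ φ : cone n → ℂ) (p : Euc n × Euc n) : ℂ :=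
  (ker s p.1 p.2 : ℂ) * (starRingEnd ℂ (ψ (flat p.1)) * φ (flat p.2))

lemma integrable_integrand {n : ℕ} {s : Param n} (ψ φ : Wave n s) :
    Integrable (integrand (s : ℝ) (ψ : cone n → ℂ) φ) (volume.prod volume) := by
  obtain ⟨C, hC⟩ := wave_bound ψ
  obtain ⟨D, hD⟩ := wave_bound φ
  refine ((integrable_ker s).const_mul (C * D)).mono' ?_ ?_
  · have h1 := (ψ.2.1.continuous.comp continuous_flat).measurable
    have h2 := (φ.2.1.continuous.comp continuous_flat).measurable
    have h3 : Measurable (fun p : Euc n × Euc n => (ψ : cone n → ℂ) (flat p.1)) :=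
      h1.comp measurable_fst
    have h4 : Measurable (fun p : Euc n × Euc n => (φ : cone n → ℂ) (flat p.2)) :=
      h2.comp measurable_snd
    exact ((Complex.measurable_ofReal.comp (measurable_ker _)).mul
      ((Complex.continuous_conj.measurable.comp h3).mul h4)).aestronglyMeasurable
  · refine Filter.Eventually.of_forall fun p => ?_
    rw [integrand, norm_mul, norm_mul, Complex.norm_real, Real.norm_of_nonneg (ker_nonneg _ _ _),
      RCLike.norm_conj]
    calc _ ≤ ker (s : ℝ) p.1 p.2 * ((C * (1 + ‖p.1‖ ^ 2) ^ (-alpha n - (s : ℝ))) *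
          (D * (1 + ‖p.2‖ ^ 2) ^ (-alpha n - (s : ℝ)))) := by
          refine mul_le_mul_of_nonneg_left ?_ (ker_nonneg _ _ _)
          exact mul_le_mul (hC _) (hD _) (norm_nonneg _) ((norm_nonneg _).trans (hC _))
      _ = _ := by ring

lemma form_eq {n : ℕ} {s : Param n} (ψ φ : Wave n s) :
    form (s : ℝ) (ψ : cone n → ℂ) φ = (cst n s : ℂ) *
      ∫ p, integrand (s : ℝ) (ψ : cone n → ℂ) φ p ∂(volume.prod volume) := by
  rw [integral_prod _ (integrable_integrand ψ φ), form, ← integral_const_mul]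
  congr 1
  funext x
  rw [inter, mul_left_comm, ← integral_const_mul]
  congr 2
  funext y
  rw [integrand, ker, mdot_flat]
  ring

lemma cst_nonneg {n : ℕ} (s : Param n) : 0 ≤ cst n s := by
  have h1 := (Real.Gamma_pos_of_pos s.2.1).le
  have h2 := (Real.Gamma_pos_of_pos (sub_pos.2 s.2.2)).le
  unfold cst
  positivity

/-- A positive superposition of squares is a positive kernel. -/
lemma re_nonneg_of_superposition {X Z : Type*} [MeasurableSpace X] [MeasurableSpace Z]
    (μ : Measure X) [SigmaFinite μ] (κ : Measure Z) [SigmaFinite κ] (f : X → ℂ)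
    (hf : Measurable f) (g : X → Z → ℝ) (hg : Measurable (Function.uncurry g))
    (hg0 : ∀ x z, 0 ≤ g x z)
    (hgi : ∀ᵐ p ∂(μ.prod μ), Integrable (fun z => g p.1 z * g p.2 z) κ)
    (hk : Integrable (fun p : X × X => ((∫ z, g p.1 z * g p.2 z ∂κ : ℝ) : ℂ) *
      (starRingEnd ℂ (f p.1) * f p.2)) (μ.prod μ)) :
    0 ≤ (∫ p : X × X, ((∫ z, g p.1 z * g p.2 z ∂κ : ℝ) : ℂ) *
      (starRingEnd ℂ (f p.1) * f p.2) ∂(μ.prod μ)).re := by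
  set T : (X × X) × Z → ℂ := fun q => ((g q.1.1 q.2 * g q.1.2 q.2 : ℝ) : ℂ) *
    (starRingEnd ℂ (f q.1.1) * f q.1.2) with hT
  have m1 : Measurable fun q : (X × X) × Z => g q.1.1 q.2 :=
    hg.comp (measurable_fst.fst.prodMk measurable_snd)
  have m2 : Measurable fun q : (X × X) × Z => g q.1.2 q.2 :=
    hg.comp (measurable_fst.snd.prodMk measurable_snd)
  have mT : Measurable T := (Complex.measurable_ofReal.comp (m1.mul m2)).mul
    ((Complex.continuous_conj.measurable.comp (hf.comp measurable_fst.fst)).mul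
      (hf.comp measurable_fst.snd))
  have hTi : Integrable T ((μ.prod μ).prod κ) := by
    rw [integrable_prod_iff mT.aestronglyMeasurable]
    constructor
    · filter_upwards [hgi] with p hp
      exact (hp.ofReal (𝕜 := ℂ)).mul_const (starRingEnd ℂ (f p.1) * f p.2)
    · refine hk.norm.congr ?_
      refine Filter.Eventually.of_forall fun p => ?_
      simp only [hT, norm_mul, Complex.norm_real]
      rw [integral_mul_const, Real.norm_of_nonneg (integral_nonneg fun z =>
        mul_nonneg (hg0 _ _) (hg0 _ _))]
      congr 2
      funext z
      rw [← norm_mul, Real.norm_of_nonneg (mul_nonneg (hg0 _ _) (hg0 _ _))]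
  have e1 : ∫ p : X × X, ((∫ z, g p.1 z * g p.2 z ∂κ : ℝ) : ℂ) *
      (starRingEnd ℂ (f p.1) * f p.2) ∂(μ.prod μ) = ∫ z, ∫ p, T (p, z) ∂(μ.prod μ) ∂κ := by
    rw [← integral_prod_symm _ hTi, integral_prod _ hTi]
    congr 1
    funext p
    simp only [hT]
    rw [integral_mul_const]
    congr 1
    exact (integral_ofReal (𝕜 := ℂ)).symm
  rw [e1]
  have hre := integral_re (𝕜 := ℂ) hTi.integral_prod_right
  rw [← RCLike.re_eq_complex_re, ← hre]
  refine integral_nonneg fun z => ?_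
  have e2 : ∀ p : X × X, T (p, z) = starRingEnd ℂ ((g p.1 z : ℂ) * f p.1) *
      ((g p.2 z : ℂ) * f p.2) := by
    intro p
    simp only [hT, map_mul, Complex.conj_ofReal]
    push_cast
    ring
  simp only [e2]
  rw [integral_prod_mul (μ := μ) (ν := μ) (fun x => starRingEnd ℂ ((g x z : ℂ) * f x))
    (fun y => (g y z : ℂ) * f y), integral_conj, ← Complex.normSq_eq_conj_mul_self]
  exact Complex.normSq_nonneg _


/-- The Gaussians into which the kernel is decomposed. -/
def gauss {n : ℕ} (β : ℝ) (x : Euc n) (q : ℝ × Euc n) : ℝ :=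
  Real.sqrt (q.1 ^ (β - 1) * (4 * q.1 / Real.pi) ^ ((n : ℝ) / 2)) *
    Real.exp (-(2 * q.1) * ‖x - q.2‖ ^ 2)

lemma gauss_mul {n : ℕ} (β : ℝ) (x y : Euc n) {t : ℝ} (ht : 0 < t) (z : Euc n) :
    gauss β x (t, z) * gauss β y (t, z) =
      t ^ (β - 1) * (4 * t / Real.pi) ^ ((n : ℝ) / 2) * Real.exp (-(t * ‖x - y‖ ^ 2)) *
        Real.exp (-(4 * t) * ‖z - (1 / 2 : ℝ) • (x + y)‖ ^ 2) := by
  have hp := Real.pi_pos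
  have h0 : 0 ≤ t ^ (β - 1) * (4 * t / Real.pi) ^ ((n : ℝ) / 2) := by positivity
  have key : 2 * (‖x - z‖ ^ 2 + ‖y - z‖ ^ 2) =
      ‖x - y‖ ^ 2 + 4 * ‖z - (1 / 2 : ℝ) • (x + y)‖ ^ 2 := by
    have h1 := parallelogram_law_with_norm ℝ (x - z) (y - z)
    have e1 : x - z - (y - z) = x - y := by abel
    have e2 : x - z + (y - z) = (-2 : ℝ) • (z - (1 / 2 : ℝ) • (x + y)) := by
      module
    rw [e1, e2, norm_smul] at h1
    norm_num at h1
    norm_num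
    linarith
  simp only [gauss]
  rw [mul_mul_mul_comm, Real.mul_self_sqrt h0, ← Real.exp_add, mul_assoc _ (Real.exp _),
    ← Real.exp_add]
  congr 2
  linear_combination (-t) * key

lemma gauss_integral {n : ℕ} {β : ℝ} (hβ : 0 < β) {x y : Euc n} (hxy : x ≠ y) :
    Integrable (fun q => gauss β x q * gauss β y q)
      ((volume.restrict (Set.Ioi 0)).prod volume) ∧
    ∫ q, gauss β x q * gauss β y q ∂((volume.restrict (Set.Ioi 0)).prod volume) =
      Real.Gamma β * (‖x - y‖ ^ 2) ^ (-β) := by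
  have hp := Real.pi_pos
  have hr : 0 < ‖x - y‖ ^ 2 := by
    have := norm_pos_iff.2 (sub_ne_zero.2 hxy)
    positivity
  have g0 : ∀ (w : Euc n) q, 0 ≤ gauss β w q := fun w q => by unfold gauss; positivity
  have hm : Measurable (fun q : ℝ × Euc n => gauss β x q * gauss β y q) := by
    unfold gauss
    fun_prop
  have hz : ∀ t : ℝ, 0 < t → Integrable (fun z : Euc n => gauss β x (t, z) * gauss β y (t, z)) := by
    intro t ht
    simp only [gauss_mul β x y ht]
    refine Integrable.const_mul ?_ _
    have := GaussianFourier.integrable_cexp_neg_mul_sq_norm_add (V := Euc n)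
      (b := ((4 * t : ℝ) : ℂ)) (by simpa using ht) 0 0
    have h2 := this.norm.comp_sub_right ((1 / 2 : ℝ) • (x + y))
    refine h2.congr (Filter.Eventually.of_forall fun z => ?_)
    simp only [Complex.norm_exp]
    congr 1
    simp
    norm_cast
    simp
  have hi : ∀ t : ℝ, 0 < t → ∫ z : Euc n, gauss β x (t, z) * gauss β y (t, z) =
      t ^ (β - 1) * Real.exp (-(‖x - y‖ ^ 2 * t)) := by
    intro t ht
    simp only [gauss_mul β x y ht]
    rw [integral_const_mul, integral_sub_right_eq_self
      (fun z : Euc n => Real.exp (-(4 * t) * ‖z‖ ^ 2)),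
      GaussianFourier.integral_rexp_neg_mul_sq_norm (V := Euc n) (by positivity)]
    simp only [finrank_euclideanSpace, Fintype.card_fin]
    have h1 : (4 * t / Real.pi) ^ ((n : ℝ) / 2) * (Real.pi / (4 * t)) ^ ((n : ℝ) / 2) = 1 := by
      rw [← Real.mul_rpow (by positivity) (by positivity)]
      have : 4 * t / Real.pi * (Real.pi / (4 * t)) = 1 := by field_simp
      rw [this, Real.one_rpow]
    rw [mul_comm (‖x - y‖ ^ 2) t]
    linear_combination (t ^ (β - 1) * Real.exp (-(t * ‖x - y‖ ^ 2))) * h1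
  have hint : IntegrableOn (fun t : ℝ => t ^ (β - 1) * Real.exp (-(‖x - y‖ ^ 2 * t)))
      (Set.Ioi 0) := by
    have := integrableOn_rpow_mul_exp_neg_mul_rpow (s := β - 1) (p := 1) (b := ‖x - y‖ ^ 2)
      (by linarith) one_pos hr
    refine this.congr_fun (fun t _ => ?_) measurableSet_Ioi
    simp
  have hI : Integrable (fun q => gauss β x q * gauss β y q)
      ((volume.restrict (Set.Ioi 0)).prod volume) := by
    rw [integrable_prod_iff hm.aestronglyMeasurable]
    constructor
    · exact (ae_restrict_mem measurableSet_Ioi).mono fun t ht => hz t ht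
    · refine hint.congr_fun (fun t ht => ?_) measurableSet_Ioi
      have ht' : 0 < t := ht
      simp only [Real.norm_of_nonneg (mul_nonneg (g0 _ _) (g0 _ _))]
      exact (hi t ht').symm
  refine ⟨hI, ?_⟩
  rw [integral_prod _ hI, setIntegral_congr_fun measurableSet_Ioi fun t ht => hi t ht,
    Real.integral_rpow_mul_exp_neg_mul_Ioi hβ hr, one_div, Real.inv_rpow hr.le, ← Real.rpow_neg hr.le]
  ring

lemma form_self_nonneg {n : ℕ} {s : Param n} (ψ : Wave n s) :
    0 ≤ (form (s : ℝ) ψ.1 ψ.1).re := by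
  have hn := s.pos_dim
  have : Nonempty (Fin n) := ⟨⟨0, hn⟩⟩
  have : Nontrivial (Euc n) := inferInstance
  set β : ℝ := alpha n - s with hβ
  have hβ0 : 0 < β := sub_pos.2 s.2.2
  have hG := Real.Gamma_pos_of_pos hβ0
  set κ : Measure (ℝ × Euc n) := (volume.restrict (Set.Ioi 0)).prod volume with hκ
  have hdiag : ∀ᵐ p : Euc n × Euc n ∂(volume.prod volume), p.1 ≠ p.2 := by
    rw [ae_iff]
    simp only [ne_eq, not_not]
    have hms : MeasurableSet {p : Euc n × Euc n | p.1 = p.2} := measurableSet_diagonal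
    rw [Measure.measure_prod_null hms]
    refine Filter.Eventually.of_forall fun x => ?_
    have : Prod.mk x ⁻¹' {p : Euc n × Euc n | p.1 = p.2} = {x} := by
      ext y; simp [eq_comm]
    change volume (Prod.mk x ⁻¹' {p : Euc n × Euc n | p.1 = p.2}) = 0
    rw [this]
    simp
  set c : ℝ := 2 ^ β / Real.Gamma β with hc
  have hc0 : 0 < c := by positivity
  have e : ∀ p : Euc n × Euc n, p.1 ≠ p.2 →
      ker (s : ℝ) p.1 p.2 = c * ∫ q, gauss β p.1 q * gauss β p.2 q ∂κ := by
    intro p hp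
    rw [(gauss_integral hβ0 hp).2, ker, show -alpha n + (s : ℝ) = -β by rw [hβ]; ring]
    have h2 : ((2 : ℝ)⁻¹) ^ (-β) = 2 ^ β := by
      rw [Real.inv_rpow (by norm_num), Real.rpow_neg (by norm_num), inv_inv]
    rw [div_eq_mul_inv, Real.mul_rpow (by positivity) (by positivity), h2, hc]
    field_simp
  set T : Euc n × Euc n → ℂ := fun p => ((∫ q, gauss β p.1 q * gauss β p.2 q ∂κ : ℝ) : ℂ) *
    (starRingEnd ℂ (ψ.1 (flat p.1)) * ψ.1 (flat p.2)) with hT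
  have eT : integrand (s : ℝ) ψ.1 ψ.1 =ᵐ[volume.prod volume] fun p => (c : ℂ) * T p := by
    filter_upwards [hdiag] with p hp
    rw [integrand, e p hp, hT]
    push_cast
    ring
  have hTi : Integrable T (volume.prod volume) := by
    have h := ((integrable_integrand ψ ψ).congr eT).const_mul ((c : ℂ)⁻¹)
    refine h.congr (Filter.Eventually.of_forall fun p => ?_)
    have : (c : ℂ) ≠ 0 := by exact_mod_cast hc0.ne'
    simp only [inv_mul_cancel_left₀ this]
  have h := re_nonneg_of_superposition (volume : Measure (Euc n)) κ (fun x => ψ.1 (flat x))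
    (ψ.2.1.continuous.comp continuous_flat).measurable (gauss β) (by
      unfold gauss Function.uncurry
      fun_prop) (fun x z => by unfold gauss; positivity) (by
      filter_upwards [hdiag] with p hp
      exact (gauss_integral hβ0 hp).1) hTi
  have e2 : form (s : ℝ) ψ.1 ψ.1 = ((cst n s * c : ℝ) : ℂ) * ∫ p, T p ∂(volume.prod volume) := by
    rw [form_eq, integral_congr_ae eT, integral_const_mul]
    push_cast
    ring
  rw [e2, Complex.re_ofReal_mul]
  exact mul_nonneg (mul_nonneg (cst_nonneg s) hc0.le) h

lemma form_conj {n : ℕ} {s : Param n} (ψ φ : Wave n s) :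
    starRingEnd ℂ (form (s : ℝ) φ.1 ψ.1) = form (s : ℝ) ψ.1 φ.1 := by
  rw [form_eq, form_eq, map_mul, Complex.conj_ofReal, ← integral_conj]
  congr 1
  rw [← integral_prod_swap]
  congr 1
  funext p
  simp only [integrand, Prod.fst_swap, Prod.snd_swap, map_mul, Complex.conj_ofReal,
    Complex.conj_conj, ker, norm_sub_rev p.2 p.1]
  ring

lemma form_add {n : ℕ} {s : Param n} (ψ χ φ : Wave n s) :
    form (s : ℝ) (ψ + χ : Wave n s).1 φ.1 = form (s : ℝ) ψ.1 φ.1 + form (s : ℝ) χ.1 φ.1 := by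
  rw [form_eq, form_eq, form_eq, ← mul_add, ← integral_add (integrable_integrand _ _)
    (integrable_integrand _ _)]
  congr 2
  funext p
  simp only [integrand, Submodule.coe_add, Pi.add_apply, map_add]
  ring

lemma form_smul {n : ℕ} {s : Param n} (ψ φ : Wave n s) (c : ℂ) :
    form (s : ℝ) (c • ψ : Wave n s).1 φ.1 = starRingEnd ℂ c * form (s : ℝ) ψ.1 φ.1 := by
  rw [form_eq, form_eq, mul_left_comm, ← integral_const_mul (starRingEnd ℂ c)]
  congr 2
  funext p
  simp only [integrand, Submodule.coe_smul, Pi.smul_apply, smul_eq_mul, map_mul]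
  ring

lemma form_conjWave {n : ℕ} {s : Param n} (ψ φ : Wave n s) :
    form (s : ℝ) (conjWave ψ : Wave n s).1 (conjWave φ : Wave n s).1 =
      starRingEnd ℂ (form (s : ℝ) ψ.1 φ.1) := by
  rw [form_eq, form_eq, map_mul, Complex.conj_ofReal, ← integral_conj]
  congr 2
  funext p
  simp only [integrand, map_mul, Complex.conj_ofReal]
  rfl

/-! ### The complementary series representation and its conjugation -/

/-- The complementary series inner product on smooth wave functions. -/
@[reducible] def waveCore (n : ℕ) (s : Param n) : PreInnerProductSpace.Core ℂ (Wave n s) where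
  inner ψ φ := form (s : ℝ) ψ.1 φ.1
  conj_inner_symm ψ φ := form_conj ψ φ
  re_inner_nonneg ψ := form_self_nonneg ψ
  add_left ψ χ φ := form_add ψ χ φ
  smul_left ψ φ c := form_smul ψ φ c

/-- The space of smooth wave functions with the complementary series inner product. -/
def PreK (n : ℕ) (s : Param n) : Type := Wave n s

instance (n : ℕ) (s : Param n) : SeminormedAddCommGroup (PreK n s) :=
  @InnerProductSpace.Core.toSeminormedAddCommGroup ℂ (Wave n s) _ _ _ (waveCore n s)

instance (n : ℕ) (s : Param n) : InnerProductSpace ℂ (PreK n s) :=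
  @InnerProductSpace.ofCore ℂ (Wave n s) _ _ _ (waveCore n s)

lemma PreK.norm_eq {n : ℕ} {s : Param n} (ψ : Wave n s) :
    ‖(show PreK n s from ψ)‖ = Real.sqrt (form (s : ℝ) ψ.1 ψ.1).re := rfl

/-- The Hilbert space `K_ν` of the complementary series representation, the completion of the
space of smooth wave functions. -/
abbrev K (n : ℕ) (s : Param n) : Type := UniformSpace.Completion (PreK n s)

/-- The vector of `K_ν` given by a smooth wave function. -/
def toK {n : ℕ} {s : Param n} : Wave n s →ₗ[ℂ] K n s :=
  (UniformSpace.Completion.toComplₗᵢ (𝕜 := ℂ) (E := PreK n s)).toLinearMap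

lemma norm_toK {n : ℕ} {s : Param n} (ψ : Wave n s) :
    ‖toK ψ‖ = Real.sqrt (form (s : ℝ) ψ.1 ψ.1).re :=
  (UniformSpace.Completion.norm_coe (E := PreK n s) ψ).trans (PreK.norm_eq ψ)

lemma denseRange_toK {n : ℕ} {s : Param n} : DenseRange (toK : Wave n s → K n s) :=
  UniformSpace.Completion.denseRange_coe (α := PreK n s)

/-- The unitary operators `V_ν(Λ)` of the complementary series representation,
`(V_ν(Λ)ψ)(P) = ψ(Λ⁻¹P)`. -/
def V {n : ℕ} {s : Param n} (Λ : lorentz n) : K n s ≃ₗᵢ[ℂ] K n s :=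
  (pull Λ : Wave n s ≃ₗ[ℂ] Wave n s).extendOfIsometry toK toK denseRange_toK denseRange_toK
    fun ψ => by rw [norm_toK, norm_toK, form_pull]

/-- The conjugation `Γ_ν` of `K_ν`, `(Γ_ν ψ)(P) = conj (ψ(P))`. -/
def Conj {n : ℕ} {s : Param n} : K n s ≃ₗᵢ⋆[ℂ] K n s :=
  (conjWave : Wave n s ≃ₛₗ[starRingEnd ℂ] Wave n s).extendOfIsometry toK toK denseRange_toK
    denseRange_toK fun ψ => by rw [norm_toK, norm_toK, form_conjWave, Complex.conj_re]

/-! ### Hilbert space tensor products -/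

section Tensor

variable {E F G E' F' : Type*}
  [NormedAddCommGroup E] [InnerProductSpace ℂ E] [NormedAddCommGroup F] [InnerProductSpace ℂ F]
  [NormedAddCommGroup G] [InnerProductSpace ℂ G] [NormedAddCommGroup E'] [InnerProductSpace ℂ E']
  [NormedAddCommGroup F'] [InnerProductSpace ℂ F']

variable (E F) in
/-- The Hilbert space tensor product, the completion of the algebraic tensor product. -/
abbrev HTensor : Type _ := UniformSpace.Completion (E ⊗[ℂ] F)

variable (E F) in
/-- The inclusion of the algebraic tensor product. -/
def incl : E ⊗[ℂ] F →ₗᵢ[ℂ] HTensor E F := UniformSpace.Completion.toComplₗᵢ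

lemma denseRange_incl : DenseRange (incl E F) :=
  UniformSpace.Completion.denseRange_coe (α := E ⊗[ℂ] F)

/-- The tensor product of two unitary operators. -/
def hmap (A : E ≃ₗᵢ[ℂ] E') (B : F ≃ₗᵢ[ℂ] F') : HTensor E F ≃ₗᵢ[ℂ] HTensor E' F' :=
  (TensorProduct.congrIsometry A B).toLinearEquiv.extendOfIsometry (incl E F).toLinearMap
    (incl E' F').toLinearMap denseRange_incl denseRange_incl fun x =>
      ((incl E' F').norm_map _).trans
        (((TensorProduct.congrIsometry A B).norm_map x).trans ((incl E F).norm_map x).symm)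

lemma inner_antiunitary (A : E ≃ₗᵢ⋆[ℂ] E') (u v : E) :
    ⟪A u, A v⟫_ℂ = starRingEnd ℂ ⟪u, v⟫_ℂ := by
  have h : A (Complex.I • v) = -(Complex.I • A v) := by
    rw [map_smulₛₗ, Complex.conj_I, neg_smul]
  have h1 : ‖A u - Complex.I • A v‖ = ‖u + Complex.I • v‖ := by
    rw [← A.norm_map (u + Complex.I • v), map_add, h, sub_eq_add_neg]
  have h2 : ‖A u + Complex.I • A v‖ = ‖u - Complex.I • v‖ := by
    rw [← A.norm_map (u - Complex.I • v), map_sub, h, sub_neg_eq_add]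
  have h3 : ‖A u + A v‖ = ‖u + v‖ := by rw [← map_add, A.norm_map]
  have h4 : ‖A u - A v‖ = ‖u - v‖ := by rw [← map_sub, A.norm_map]
  rw [inner_eq_sum_norm_sq_div_four, inner_eq_sum_norm_sq_div_four u v]
  simp only [RCLike.I_to_complex, h1, h2, h3, h4, RCLike.ofReal_eq_complex_ofReal]
  simp only [map_div₀, map_add, map_sub, map_mul, map_pow, Complex.conj_ofReal, Complex.conj_I,
    map_ofNat]
  ring

lemma inner_congr_conj (A : E ≃ₗᵢ⋆[ℂ] E') (B : F ≃ₗᵢ⋆[ℂ] F') (x y : E ⊗[ℂ] F) :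
    ⟪TensorProduct.congr A.toLinearEquiv B.toLinearEquiv x,
      TensorProduct.congr A.toLinearEquiv B.toLinearEquiv y⟫_ℂ = starRingEnd ℂ ⟪x, y⟫_ℂ := by
  induction x using TensorProduct.induction_on with
  | zero => simp
  | add x x' hx hx' => simp only [map_add, inner_add_left, hx, hx']
  | tmul a b =>
    induction y using TensorProduct.induction_on with
    | zero => simp
    | add y y' hy hy' => simp only [map_add, inner_add_right, hy, hy']
    | tmul c d =>
      simp only [TensorProduct.congr_tmul, TensorProduct.inner_tmul, map_mul]
      exact congrArg₂ _ (inner_antiunitary A _ _) (inner_antiunitary B _ _)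

/-- The tensor product of two antiunitary operators. -/
def hmapConj (A : E ≃ₗᵢ⋆[ℂ] E') (B : F ≃ₗᵢ⋆[ℂ] F') : HTensor E F ≃ₗᵢ⋆[ℂ] HTensor E' F' :=
  (TensorProduct.congr A.toLinearEquiv B.toLinearEquiv).extendOfIsometry (incl E F).toLinearMap
    (incl E' F').toLinearMap denseRange_incl denseRange_incl fun x => by
      refine ((incl E' F').norm_map _).trans (Eq.trans ?_ ((incl E F).norm_map x).symm)
      rw [@norm_eq_sqrt_re_inner ℂ, @norm_eq_sqrt_re_inner ℂ _ _ _ _ x, inner_congr_conj,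
        RCLike.conj_re]

variable (E F) in
/-- The flip `F (k₁ ⊗ k₂) = k₂ ⊗ k₁`. -/
def flip : HTensor E F ≃ₗᵢ[ℂ] HTensor F E :=
  (TensorProduct.commIsometry ℂ E F).toLinearEquiv.extendOfIsometry (incl E F).toLinearMap
    (incl F E).toLinearMap denseRange_incl denseRange_incl fun x =>
      ((incl F E).norm_map _).trans
        (((TensorProduct.commIsometry ℂ E F).norm_map x).trans ((incl E F).norm_map x).symm)

lemma denseRange_rTensor (f : E →ₗᵢ[ℂ] E') (hf : DenseRange f) :
    DenseRange (f.rTensor F) := by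
  let S : Submodule ℂ (E' ⊗[ℂ] F) := (LinearMap.range (f.rTensor F).toLinearMap).topologicalClosure
  have hS : ∀ x, x ∈ S := by
    intro x
    induction x using TensorProduct.induction_on with
    | zero => exact S.zero_mem
    | add x y hx hy => exact S.add_mem hx hy
    | tmul u v =>
      refine hf.induction_on (p := fun u => u ⊗ₜ[ℂ] v ∈ S) u ?_ fun e => ?_
      · exact (Submodule.isClosed_topologicalClosure _).preimage
          (TensorProduct.continuous_tmul.comp (continuous_id.prodMk continuous_const))
      · exact Submodule.le_topologicalClosure _ ⟨e ⊗ₜ v, rfl⟩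
  intro x
  exact hS x

lemma denseRange_lTensor (f : E →ₗᵢ[ℂ] E') (hf : DenseRange f) :
    DenseRange (f.lTensor F) := by
  let S : Submodule ℂ (F ⊗[ℂ] E') := (LinearMap.range (f.lTensor F).toLinearMap).topologicalClosure
  have hS : ∀ x, x ∈ S := by
    intro x
    induction x using TensorProduct.induction_on with
    | zero => exact S.zero_mem
    | add x y hx hy => exact S.add_mem hx hy
    | tmul v u =>
      refine hf.induction_on (p := fun u => v ⊗ₜ[ℂ] u ∈ S) u ?_ fun e => ?_
      · exact (Submodule.isClosed_topologicalClosure _).preimage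
          (TensorProduct.continuous_tmul.comp (continuous_const.prodMk continuous_id))
      · exact Submodule.le_topologicalClosure _ ⟨v ⊗ₜ e, rfl⟩
  intro x
  exact hS x

variable (E F G) in
/-- The associator `(E ⊗ F) ⊗ G ≅ E ⊗ (F ⊗ G)` of the Hilbert space tensor product. -/
def assoc : HTensor (HTensor E F) G ≃ₗᵢ[ℂ] HTensor E (HTensor F G) :=
  (TensorProduct.assocIsometry ℂ E F G).toLinearEquiv.extendOfIsometry
    ((incl (HTensor E F) G).comp ((incl E F).rTensor G)).toLinearMap
    ((incl E (HTensor F G)).comp ((incl F G).lTensor E)).toLinearMap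
    (denseRange_incl.comp (denseRange_rTensor _ denseRange_incl) (incl _ _).continuous)
    (denseRange_incl.comp (denseRange_lTensor _ denseRange_incl) (incl _ _).continuous)
    fun x => by
      refine (LinearIsometry.norm_map _ _).trans (Eq.trans ?_ (LinearIsometry.norm_map _ _).symm)
      exact (TensorProduct.assocIsometry ℂ E F G).norm_map x

end Tensor

section TensorLemmas

variable {E F G E' F' G' E'' F'' H : Type*}
  [NormedAddCommGroup H] [InnerProductSpace ℂ H]
  [NormedAddCommGroup E] [InnerProductSpace ℂ E] [NormedAddCommGroup F] [InnerProductSpace ℂ F]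
  [NormedAddCommGroup G] [InnerProductSpace ℂ G] [NormedAddCommGroup E'] [InnerProductSpace ℂ E']
  [NormedAddCommGroup F'] [InnerProductSpace ℂ F'] [NormedAddCommGroup G']
  [InnerProductSpace ℂ G'] [NormedAddCommGroup E''] [InnerProductSpace ℂ E'']
  [NormedAddCommGroup F''] [InnerProductSpace ℂ F'']

/-- The product vector `x ⊗ y` in the Hilbert space tensor product. -/
def tm (x : E) (y : F) : HTensor E F := incl E F (x ⊗ₜ y)

lemma continuous_tm : Continuous fun p : E × F => tm p.1 p.2 :=
  (incl E F).continuous.comp TensorProduct.continuous_tmul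

lemma hmap_tm (A : E ≃ₗᵢ[ℂ] E') (B : F ≃ₗᵢ[ℂ] F') (x : E) (y : F) :
    hmap A B (tm x y) = tm (A x) (B y) :=
  LinearEquiv.extendOfIsometry_eq _ (incl E F).toLinearMap (incl E' F').toLinearMap _ _ _ _

lemma htensor_induction {p : HTensor E F → Prop} (hp : IsClosed {x | p x})
    (hadd : ∀ x y, p x → p y → p (x + y)) (h0 : p 0) (h : ∀ x y, p (tm x y)) (x : HTensor E F) :
    p x := by
  refine denseRange_incl.induction_on (p := p) x hp fun z => ?_
  induction z using TensorProduct.induction_on with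
  | zero => rw [map_zero]; exact h0
  | tmul a b => exact h a b
  | add a b ha hb => rw [map_add]; exact hadd _ _ ha hb

lemma hext {L L' : HTensor E F ≃ₗᵢ[ℂ] H} (h : ∀ x y, L (tm x y) = L' (tm x y)) : L = L' := by
  refine LinearIsometryEquiv.ext fun x => ?_
  refine htensor_induction (p := fun x => L x = L' x) ?_ ?_ ?_ h x
  · exact isClosed_eq L.continuous L'.continuous
  · intro x y hx hy
    rw [map_add, map_add, hx, hy]
  · rw [map_zero, map_zero]

lemma hext_three {L L' : HTensor (HTensor E F) G ≃ₗᵢ[ℂ] H}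
    (h : ∀ x y z, L (tm (tm x y) z) = L' (tm (tm x y) z)) : L = L' := by
  refine hext fun u z => ?_
  refine htensor_induction (p := fun u => L (tm u z) = L' (tm u z)) ?_ ?_ ?_ (fun x y => h x y z) u
  · have hc : Continuous fun u : HTensor E F => tm u z :=
      continuous_tm.comp (continuous_id.prodMk continuous_const)
    exact isClosed_eq (L.continuous.comp hc) (L'.continuous.comp hc)
  · intro u v hu hv
    have ha : tm (u + v) z = tm u z + tm v z := by
      simp only [tm, TensorProduct.add_tmul, map_add]
    rw [ha, map_add, map_add, hu, hv]
  · have h0 : tm (0 : HTensor E F) z = 0 := by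
      simp only [tm, TensorProduct.zero_tmul, map_zero]
    rw [h0, map_zero, map_zero]

lemma hmap_trans (A : E ≃ₗᵢ[ℂ] E') (B : F ≃ₗᵢ[ℂ] F') (A' : E' ≃ₗᵢ[ℂ] E'') (B' : F' ≃ₗᵢ[ℂ] F'') :
    (hmap A B).trans (hmap A' B') = hmap (A.trans A') (B.trans B') := by
  refine hext fun x y => ?_
  rw [LinearIsometryEquiv.trans_apply, hmap_tm, hmap_tm, hmap_tm]
  rfl

lemma hmap_hmap (A : E ≃ₗᵢ[ℂ] E') (B : F ≃ₗᵢ[ℂ] F') (A' : E' ≃ₗᵢ[ℂ] E'') (B' : F' ≃ₗᵢ[ℂ] F'')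
    (x : HTensor E F) : hmap A' B' (hmap A B x) = hmap (A.trans A') (B.trans B') x := by
  rw [← hmap_trans, LinearIsometryEquiv.trans_apply]

lemma assoc_tm (x : E) (y : F) (z : G) : assoc E F G (tm (tm x y) z) = tm x (tm y z) :=
  LinearEquiv.extendOfIsometry_eq _
    ((incl (HTensor E F) G).comp ((incl E F).rTensor G)).toLinearMap
    ((incl E (HTensor F G)).comp ((incl F G).lTensor E)).toLinearMap _ _ _ ((x ⊗ₜ y) ⊗ₜ z)

lemma hmap_assoc (A : E ≃ₗᵢ[ℂ] E') (B : F ≃ₗᵢ[ℂ] F') (C : G ≃ₗᵢ[ℂ] G') :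
    (hmap (hmap A B) C).trans (assoc E' F' G') = (assoc E F G).trans (hmap A (hmap B C)) := by
  refine hext_three fun x y z => ?_
  rw [LinearIsometryEquiv.trans_apply, LinearIsometryEquiv.trans_apply, hmap_tm, hmap_tm,
    assoc_tm, assoc_tm, hmap_tm, hmap_tm]

lemma assoc_hmap (A : E ≃ₗᵢ[ℂ] E') (B : F ≃ₗᵢ[ℂ] F') (C : G ≃ₗᵢ[ℂ] G')
    (x : HTensor (HTensor E F) G) :
    assoc E' F' G' (hmap (hmap A B) C x) = hmap A (hmap B C) (assoc E F G x) := by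
  rw [← LinearIsometryEquiv.trans_apply, hmap_assoc, LinearIsometryEquiv.trans_apply]

end TensorLemmas

/-! ### Tensor powers and Yang-Baxter functions -/

section Power

variable {E G : Type} [NormedAddCommGroup E] [InnerProductSpace ℂ E]
  [NormedAddCommGroup G] [InnerProductSpace ℂ G]

/-- The operator `R ⊗ 1` on `E ⊗ (E ⊗ G)`. -/
def legFirst (G : Type) [NormedAddCommGroup G] [InnerProductSpace ℂ G]
    (R : HTensor E E ≃ₗᵢ[ℂ] HTensor E E) :
    HTensor E (HTensor E G) ≃ₗᵢ[ℂ] HTensor E (HTensor E G) :=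
  ((assoc E E G).symm.trans (hmap R (LinearIsometryEquiv.refl ℂ G))).trans (assoc E E G)


/-- The operator `1 ⊗ B` on `E ⊗ G`. -/
def legRest (E : Type) [NormedAddCommGroup E] [InnerProductSpace ℂ E] (B : G ≃ₗᵢ[ℂ] G) :
    HTensor E G ≃ₗᵢ[ℂ] HTensor E G := hmap (LinearIsometryEquiv.refl ℂ E) B

lemma legFirst_assoc (R : HTensor E E ≃ₗᵢ[ℂ] HTensor E E) (y : HTensor (HTensor E E) G) :
    legFirst G R (assoc E E G y) = assoc E E G (hmap R (LinearIsometryEquiv.refl ℂ G) y) := by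
  rw [legFirst, LinearIsometryEquiv.trans_apply, LinearIsometryEquiv.trans_apply,
    LinearIsometryEquiv.symm_apply_apply]

lemma hmap_comm {A C : E ≃ₗᵢ[ℂ] E} {B D : G ≃ₗᵢ[ℂ] G} (h : ∀ x, C (A x) = A (C x))
    (h' : ∀ x, D (B x) = B (D x)) (x : HTensor E G) :
    hmap C D (hmap A B x) = hmap A B (hmap C D x) := by
  have e : A.trans C = C.trans A := LinearIsometryEquiv.ext h
  have e' : B.trans D = D.trans B := LinearIsometryEquiv.ext h'
  rw [hmap_hmap, hmap_hmap, e, e']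

lemma legFirst_hmap (R : HTensor E E ≃ₗᵢ[ℂ] HTensor E E) (A : E ≃ₗᵢ[ℂ] E)
    (hR : ∀ x, R (hmap A A x) = hmap A A (R x)) (B : G ≃ₗᵢ[ℂ] G) (x : HTensor E (HTensor E G)) :
    legFirst G R (hmap A (hmap A B) x) = hmap A (hmap A B) (legFirst G R x) := by
  have key : ∀ y, legFirst G R (hmap A (hmap A B) (assoc E E G y)) =
      hmap A (hmap A B) (legFirst G R (assoc E E G y)) := fun y => by
    rw [← assoc_hmap, legFirst_assoc, legFirst_assoc, ← assoc_hmap,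
      hmap_comm (E := HTensor E E) (C := R) (B := B) (D := LinearIsometryEquiv.refl ℂ G) hR (fun _ => rfl)]
  have h := key ((assoc E E G).symm x)
  rwa [LinearIsometryEquiv.apply_symm_apply] at h

lemma legRest_hmap (B C : G ≃ₗᵢ[ℂ] G) (A : E ≃ₗᵢ[ℂ] E) (h : ∀ x, B (C x) = C (B x))
    (x : HTensor E G) : legRest E B (hmap A C x) = hmap A C (legRest E B x) := by
  rw [legRest, hmap_comm (A := A) (C := LinearIsometryEquiv.refl ℂ E) (D := B) (fun _ => rfl) h]

/-- Bundled Hilbert spaces, used for the recursive definition of tensor powers. -/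
structure Hilb where
  carrier : Type
  [grp : NormedAddCommGroup carrier]
  [ips : InnerProductSpace ℂ carrier]
  [complete : CompleteSpace carrier]

/-- The Hilbert space tensor product `E ⊗ X` as a bundled Hilbert space. -/
def Hilb.tensor (E : Type) [NormedAddCommGroup E] [InnerProductSpace ℂ E] (X : Hilb) : Hilb :=
  letI := X.grp
  letI := X.ips
  Hilb.mk (HTensor E X.carrier)

/-- The tensor powers of a Hilbert space: `E^{⊗0} = ℂ`, `E^{⊗(m+1)} = E ⊗ E^{⊗m}`. -/
def tpow (E : Type) [NormedAddCommGroup E] [InnerProductSpace ℂ E] : ℕ → Hilb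
  | 0 => Hilb.mk ℂ
  | m + 1 => Hilb.tensor E (tpow E m)

/-- The Hilbert space `E^{⊗m}`. -/
abbrev Pow (E : Type) [NormedAddCommGroup E] [InnerProductSpace ℂ E] (m : ℕ) : Type :=
  (tpow E m).carrier

instance (m : ℕ) : NormedAddCommGroup (Pow E m) := (tpow E m).grp
instance (m : ℕ) : InnerProductSpace ℂ (Pow E m) := (tpow E m).ips
instance (m : ℕ) : CompleteSpace (Pow E m) := (tpow E m).complete

/-- The operator acting by `R` on the tensor factors `k` and `k + 1` (counted from zero) of
`E^{⊗m}`; by convention it is the identity if `m ≤ k + 1`. -/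
def leg (R : HTensor E E ≃ₗᵢ[ℂ] HTensor E E) : (m k : ℕ) → (Pow E m ≃ₗᵢ[ℂ] Pow E m)
  | 0, _ => LinearIsometryEquiv.refl ℂ _
  | m + 1, k + 1 => (legRest E (leg R m k) : HTensor E (Pow E m) ≃ₗᵢ[ℂ] _)
  | m + 2, 0 => (legFirst (Pow E m) R : HTensor E (HTensor E (Pow E m)) ≃ₗᵢ[ℂ] _)
  | 1, 0 => LinearIsometryEquiv.refl ℂ _

/-- The operator `A^{⊗m}` on `E^{⊗m}`. -/
def powMap (A : E ≃ₗᵢ[ℂ] E) : (m : ℕ) → (Pow E m ≃ₗᵢ[ℂ] Pow E m)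
  | 0 => LinearIsometryEquiv.refl ℂ _
  | m + 1 => (hmap A (powMap A m) : HTensor E (Pow E m) ≃ₗᵢ[ℂ] _)

lemma leg_powMap (R : HTensor E E ≃ₗᵢ[ℂ] HTensor E E) (A : E ≃ₗᵢ[ℂ] E)
    (hR : ∀ x, R (hmap A A x) = hmap A A (R x)) : ∀ (m k : ℕ) (x : Pow E m),
    leg R m k (powMap A m x) = powMap A m (leg R m k x)
  | m + 2, 0, x => legFirst_hmap R A hR (powMap A m) x
  | m + 1, k + 1, x => legRest_hmap (leg R m k) (powMap A m) A (leg_powMap R A hR m k) x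
  | 0, _, _ => rfl
  | 1, 0, _ => rfl

/-- Tensoring from the left with a vector, `E^{⊗m} → E^{⊗(m+1)}`, `y ↦ x ⊗ y`. -/
def tensL (x : E) (m : ℕ) : Pow E m →L[ℂ] Pow E (m + 1) :=
  ((incl E (Pow E m)).toContinuousLinearMap ∘L TensorProduct.mkL ℂ E (Pow E m) x :
    Pow E m →L[ℂ] HTensor E (Pow E m))

lemma powMap_tensL (A : E ≃ₗᵢ[ℂ] E) (x : E) (m : ℕ) (y : Pow E m) :
    powMap A (m + 1) (tensL x m y) = tensL (A x) m (powMap A m y) :=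
  hmap_tm A (powMap A m) x y

end Power

/-- An invariant Yang-Baxter function for the complementary series representation `V_ν` of
`SO↑(d,1)` and its conjugation `Γ_ν`: a family of unitaries `R(θ)`, `θ ∈ ℝ`, on
`K_ν ⊗ K_ν` with the following properties. -/
structure InvariantYBFunction (n : ℕ) (s : Param n) where
  toFun : ℝ → (HTensor (K n s) (K n s) ≃ₗᵢ[ℂ] HTensor (K n s) (K n s))
  /-- `[R(θ), V(Λ) ⊗ V(Λ)] = 0`. -/
  invariant : ∀ (t : ℝ) (Λ : lorentz n) (x : HTensor (K n s) (K n s)),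
    toFun t (hmap (V Λ) (V Λ) x) = hmap (V Λ) (V Λ) (toFun t x)
  /-- `(Γ ⊗ Γ) F R(-θ) F (Γ ⊗ Γ) = R(θ)`. -/
  tcp : ∀ (t : ℝ) (x : HTensor (K n s) (K n s)),
    hmapConj Conj Conj (flip _ _ (toFun (-t) (flip _ _ (hmapConj Conj Conj x)))) = toFun t x
  /-- The Yang-Baxter equation with spectral parameter,
  `(R(θ) ⊗ 1)(1 ⊗ R(θ+θ'))(R(θ') ⊗ 1) = (1 ⊗ R(θ'))(R(θ+θ') ⊗ 1)(1 ⊗ R(θ))`. -/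
  yang_baxter : ∀ (t u : ℝ) (x : HTensor (K n s) (HTensor (K n s) (K n s))),
    legFirst _ (toFun t) (legRest _ (toFun (t + u)) (legFirst _ (toFun u) x)) =
      legRest _ (toFun u) (legFirst _ (toFun (t + u)) (legRest _ (toFun t) x))
  /-- `R(-θ) = R(θ)⁻¹`. -/
  inverse : ∀ t : ℝ, toFun (-t) = (toFun t).symm

/-! ### The `R`-symmetric Fock space -/

section Fock

variable {E : Type} [NormedAddCommGroup E] [InnerProductSpace ℂ E] {N : ℕ}

variable (E N) in
/-- The one-particle space `H₁ = ℂ^N ⊗ E`, as the space of `N`-tuples of vectors in `E`. -/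
abbrev H1 : Type := PiLp 2 (fun _ : Fin N => E)

variable (E N) in
/-- The tensor power `H₁^{⊗m} = (ℂ^N)^{⊗m} ⊗ E^{⊗m}`: vectors with components `Ψ_J ∈ E^{⊗m}`
labelled by multi-indices `J = (j₁, …, j_m)`. -/
abbrev HPow (m : ℕ) : Type := PiLp 2 (fun _ : Fin m → Fin N => Pow E m)

/-- `ξ ⊗ Ψ ∈ H₁^{⊗(m+1)}` for `ξ ∈ H₁` and `Ψ ∈ H₁^{⊗m}`, with components
`(ξ ⊗ Ψ)_{(j₀, …, j_m)} = ξ_{j₀} ⊗ Ψ_{(j₁, …, j_m)}`. -/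
def tensH (ξ : H1 E N) (m : ℕ) : HPow E N m →L[ℂ] HPow E N (m + 1) :=
  ((PiLp.continuousLinearEquiv 2 ℂ (fun _ : Fin (m + 1) → Fin N => Pow E (m + 1))).symm :
      ((Fin (m + 1) → Fin N) → Pow E (m + 1)) →L[ℂ] HPow E N (m + 1)) ∘L
    ContinuousLinearMap.pi fun J : Fin (m + 1) → Fin N =>
      tensL (ξ (J 0)) m ∘L PiLp.proj 2 (fun _ : Fin m → Fin N => Pow E m) (Fin.tail J)

variable (R : ℝ → (HTensor E E ≃ₗᵢ[ℂ] HTensor E E)) (θ : Fin N → ℝ)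

/-- The operator `D(τ_k)` on `H₁^{⊗m}` representing the transposition of the neighbours `k` and
`k + 1` (counted from zero), i.e. the operator `(R Ψ)_{jl} = R_{θ_j - θ_l} Ψ_{lj}` acting on the
tensor factors `k` and `k + 1`. -/
def transp (m k : ℕ) (hk : k + 1 < m) (Ψ : HPow E N m) : HPow E N m :=
  WithLp.toLp 2 fun J => leg (R (θ (J ⟨k, by omega⟩) - θ (J ⟨k + 1, hk⟩))) m k
    (Ψ (J ∘ Equiv.swap ⟨k, by omega⟩ ⟨k + 1, hk⟩))

/-- The `R`-symmetric `m`-particle space `H_m^R`: the subspace of `H₁^{⊗m}` on which the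
representation of the symmetric group generated by the neighbour transpositions acts trivially. -/
def Sym (m : ℕ) : Submodule ℂ (HPow E N m) where
  carrier := {Ψ | ∀ (k : ℕ) (hk : k + 1 < m), transp R θ m k hk Ψ = Ψ}
  zero_mem' k hk := by
    ext J
    simp [transp]
  add_mem' {Ψ Φ} h h' k hk := by
    conv_rhs => rw [← h k hk, ← h' k hk]
    ext J
    simp [transp]
  smul_mem' c Ψ h k hk := by
    conv_rhs => rw [← h k hk]
    ext J
    simp [transp]

lemma continuous_transp (m k : ℕ) (hk : k + 1 < m) :
    Continuous (transp R θ m k hk : HPow E N m → HPow E N m) := by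
  refine (PiLp.continuous_toLp 2 _).comp (continuous_pi fun J => ?_)
  exact (LinearIsometryEquiv.continuous _).comp
    ((continuous_apply _).comp (PiLp.continuous_ofLp 2 _))

instance (m : ℕ) : CompleteSpace (Sym R θ m) := by
  refine IsClosed.completeSpace_coe (hs := ?_)
  have : ((Sym R θ m : Submodule ℂ (HPow E N m)) : Set (HPow E N m)) =
      ⋂ (k : ℕ) (hk : k + 1 < m), {Ψ | transp R θ m k hk Ψ = Ψ} := by
    ext Ψ
    simp [Sym]
  rw [this]
  exact isClosed_iInter fun k => isClosed_iInter fun hk =>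
    isClosed_eq (continuous_transp R θ m k hk) continuous_id

/-- The `R`-symmetric Fock space `H^R = ⨁ H_m^R`. -/
abbrev Fock : Type := lp (fun m : ℕ => Sym R θ m) 2

/-- The vector in Fock space given by an `m`-particle vector. -/
def single (m : ℕ) (Ψ : Sym R θ m) : Fock R θ := lp.single 2 m Ψ

/-- The creation operator `z†(ξ)` on `m`-particle vectors,
`z†(ξ) Ψ = √(m+1) P_{m+1} (ξ ⊗ Ψ)`. -/
def creation (ξ : H1 E N) (m : ℕ) : Sym R θ m →L[ℂ] Sym R θ (m + 1) :=
  ((Real.sqrt (m + 1) : ℝ) : ℂ) • ((Sym R θ (m + 1)).orthogonalProjectionOnto ∘L tensH ξ m ∘L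
    (Sym R θ m).subtypeL)

/-- The annihilation operator `z(ξ) = z†(ξ)*` on `(m+1)`-particle vectors. -/
def annihilation (ξ : H1 E N) (m : ℕ) : Sym R θ (m + 1) →L[ℂ] Sym R θ m :=
  ContinuousLinearMap.adjoint (creation R θ ξ m)

/-- The field operator `z†(ξ) + z(ξ)` on vectors of fixed particle number. -/
def field (ξ : H1 E N) : (m : ℕ) → Sym R θ m → Fock R θ
  | 0, Ψ => single R θ 1 (creation R θ ξ 0 Ψ)
  | m + 1, Ψ => single R θ (m + 2) (creation R θ ξ (m + 1) Ψ) +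
      single R θ m (annihilation R θ ξ m Ψ)

/-- `W` is the unitary operator `e^{iA}`, where `A` is an essentially self-adjoint operator on the
finite particle vectors, given by its action `A m Ψ` on `m`-particle vectors `Ψ`: there is a
strongly continuous one-parameter unitary group `U(t) = e^{itA}`, whose derivative at `t = 0` on
the finite particle vectors is `iA`, and `W = U(1)`. -/
def IsExpI (A : (m : ℕ) → Sym R θ m → Fock R θ) (W : Fock R θ →L[ℂ] Fock R θ) : Prop :=
  ∃ U : ℝ → (Fock R θ →L[ℂ] Fock R θ),
    U 0 = 1 ∧ (∀ t u, U (t + u) = U t * U u) ∧ (∀ t, U t ∈ unitary (Fock R θ →L[ℂ] Fock R θ)) ∧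
    (∀ v, Continuous fun t => U t v) ∧
    (∀ m Ψ, Filter.Tendsto
      (fun t : ℝ => ((t⁻¹ : ℝ) : ℂ) • (U t (single R θ m Ψ) - single R θ m Ψ))
      (nhdsWithin 0 {0}ᶜ) (nhds (Complex.I • A m Ψ))) ∧ U 1 = W

/-- The von Neumann algebra (double commutant) generated by the exponentiated fields
`e^{i(z†(ξ) + z(ξ))}`, `ξ ∈ S`. -/
def fieldAlg (S : Set (H1 E N)) : Set (Fock R θ →L[ℂ] Fock R θ) :=
  Set.centralizer (Set.centralizer {W | ∃ ξ ∈ S, IsExpI R θ (field R θ ξ) W})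

/-! ### Second quantization -/

lemma transp_powMap (A : E ≃ₗᵢ[ℂ] E) (hA : ∀ t x, R t (hmap A A x) = hmap A A (R t x))
    (m k : ℕ) (hk : k + 1 < m) (Ψ : HPow E N m) :
    transp R θ m k hk (WithLp.toLp 2 fun J => powMap A m (Ψ J)) =
      WithLp.toLp 2 fun J => powMap A m (transp R θ m k hk Ψ J) := by
  ext J
  exact leg_powMap _ A (hA _) m k _

variable (N) in
/-- `A^{⊗m}` on `H₁^{⊗m} = (ℂ^N)^{⊗m} ⊗ E^{⊗m}`, acting trivially on the first factor. -/
def powMapH (A : E ≃ₗᵢ[ℂ] E) (m : ℕ) : HPow E N m ≃ₗᵢ[ℂ] HPow E N m :=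
  LinearIsometryEquiv.piLpCongrRight 2 fun _ => powMap A m

lemma powMapH_mem (A : E ≃ₗᵢ[ℂ] E) (hA : ∀ t x, R t (hmap A A x) = hmap A A (R t x)) (m : ℕ)
    (Ψ : HPow E N m) : powMapH N A m Ψ ∈ Sym R θ m ↔ Ψ ∈ Sym R θ m := by
  have h : ∀ k hk, transp R θ m k hk (powMapH N A m Ψ) =
      powMapH N A m (transp R θ m k hk Ψ) := fun k hk => transp_powMap R θ A hA m k hk Ψ
  change (∀ k hk, _ = _) ↔ (∀ k hk, _ = _)
  simp only [h, EmbeddingLike.apply_eq_iff_eq]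

/-- The restriction of `A^{⊗m}` to the `R`-symmetric `m`-particle space. -/
def symMap (A : E ≃ₗᵢ[ℂ] E) (hA : ∀ t x, R t (hmap A A x) = hmap A A (R t x)) (m : ℕ) :
    Sym R θ m ≃ₗᵢ[ℂ] Sym R θ m where
  toFun Ψ := ⟨powMapH N A m Ψ, (powMapH_mem R θ A hA m _).2 Ψ.2⟩
  invFun Ψ := ⟨(powMapH N A m).symm Ψ, (powMapH_mem R θ A hA m _).1 (by
    rw [LinearIsometryEquiv.apply_symm_apply]; exact Ψ.2)⟩
  map_add' Ψ Φ := Subtype.ext (map_add _ _ _)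
  map_smul' c Ψ := Subtype.ext (map_smul _ _ _)
  left_inv Ψ := Subtype.ext (LinearIsometryEquiv.symm_apply_apply _ _)
  right_inv Ψ := Subtype.ext (LinearIsometryEquiv.apply_symm_apply _ _)
  norm_map' Ψ := (powMapH N A m).norm_map Ψ

lemma memℓp_map {X : ℕ → Type} [∀ m, NormedAddCommGroup (X m)] {x y : (m : ℕ) → X m}
    (h : ∀ m, ‖y m‖ = ‖x m‖) (hx : Memℓp x 2) : Memℓp y 2 := by
  rw [memℓp_gen_iff (by norm_num)] at hx ⊢
  simpa only [h] using hx

/-- The direct sum of unitary operators. -/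
def lpMap {X : ℕ → Type} [∀ m, NormedAddCommGroup (X m)] [∀ m, InnerProductSpace ℂ (X m)]
    (A : ∀ m, X m ≃ₗᵢ[ℂ] X m) : lp X 2 ≃ₗᵢ[ℂ] lp X 2 where
  toFun x := ⟨fun m => A m (x m), memℓp_map (fun m => (A m).norm_map _) x.2⟩
  invFun x := ⟨fun m => (A m).symm (x m), memℓp_map (fun m => (A m).symm.norm_map _) x.2⟩
  map_add' x y := lp.ext (funext fun m => map_add (A m) _ _)
  map_smul' c x := lp.ext (funext fun m => map_smul (A m) _ _)
  left_inv x := lp.ext (funext fun m => (A m).symm_apply_apply _)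
  right_inv x := lp.ext (funext fun m => (A m).apply_symm_apply _)
  norm_map' x := by
    rw [lp.norm_eq_tsum_rpow (by norm_num), lp.norm_eq_tsum_rpow (by norm_num)]
    congr 2
    funext m
    exact congrArg (· ^ _) ((A m).norm_map _)

/-- The second quantization of a unitary `A` such that `A ⊗ A` commutes with `R`: the operator
acting by `A^{⊗m}` on `m`-particle vectors. -/
def secondQuant (A : E ≃ₗᵢ[ℂ] E) (hA : ∀ t x, R t (hmap A A x) = hmap A A (R t x)) :
    Fock R θ ≃ₗᵢ[ℂ] Fock R θ := lpMap (symMap R θ A hA)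

end Fock

/-! ### The net of von Neumann algebras -/

section Net

variable {n : ℕ} {s : Param n} (R : InvariantYBFunction n s) {N : ℕ} (θ : Fin N → ℝ)

/-- The `R`-symmetric Fock space over `ℂ^N ⊗ K_ν`. -/
abbrev HR : Type := Fock R.toFun θ

/-- The representation of `SO↑(d,1)` on the `R`-symmetric Fock space. -/
def VR (Λ : lorentz n) : HR R θ ≃ₗᵢ[ℂ] HR R θ :=
  secondQuant R.toFun θ (V Λ) (fun t x => R.invariant t Λ x)

variable (s) in
/-- Real smooth wave functions on `B` with support in the region `O ⊆ B`, the test functions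
of `C^∞_{ℝ,0}(O)`. (The ray projection of the support is the support on `B`.) -/
def testFun (O : Set (Base n)) : Set (Wave n s) :=
  {f | (∀ P, ((f : cone n → ℂ) P).im = 0) ∧ tsupport (f : cone n → ℂ) ⊆ ray ⁻¹' O}

/-- The vector `e_j ⊗ f` of the one-particle space `ℂ^N ⊗ K_ν`. -/
def vec (j : Fin N) (f : Wave n s) : H1 (K n s) N := WithLp.toLp 2 (Pi.single j (toK f))

/-- The von Neumann algebra `E_R(O) = {e^{iφ_{R,j}(f)} | f ∈ C^∞_{ℝ,0}(O), j = 1, …, N}''`. -/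
def algE (O : Set (Base n)) : Set (HR R θ →L[ℂ] HR R θ) :=
  fieldAlg R.toFun θ {ξ | ∃ (j : Fin N) (f : Wave n s), f ∈ testFun s O ∧ ξ = vec j f}

/-- The von Neumann algebra `F_R(O) = E_R(O) ∩ E_R(O')'`, `O' = B ∖ O`. -/
def algF (O : Set (Base n)) : Set (HR R θ →L[ℂ] HR R θ) :=
  algE R θ O ∩ Set.centralizer (algE R θ Oᶜ)

end Net

end DeSitter

end

open DeSitter

/-!
The algebras `F_R(O) = E_R(O) ∩ E_R(O')'` are built from commutants, and the three claims reduce to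
properties of the generators `e^{iφ(ξ)}`.

* The generators of each `E_R(S)` form a set closed under adjoints, since the adjoint of `e^{iφ(ξ)}`
  is `e^{iφ(-ξ)}` (`star_mem_expField`). Hence `F_R(O)`, which is the commutant of
  `E_R(O)' ∪ E_R(O')`, is the commutant of a self-adjoint set, i.e. a von Neumann algebra.
* `S ↦ E_R(S)` is monotone and `S ↦ E_R(S')'` is too, so `F_R` is a net. If `O₁` and `O₂` are
  disjoint, then `F_R(O₁) ⊆ E_R(O₁) ⊆ E_R(O₂')`, while `F_R(O₂)` lies in the commutant of `E_R(O₂')`;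
  this is locality.
* A second quantized unitary `Γ(A)` intertwines `z†(ξ)` with `z†(Aξ)` because it preserves the
  subspaces of `R`-symmetric vectors and so commutes with the projections onto them
  (`symMap_creation`); taking adjoints, the same holds for `z(ξ)`. Therefore
  `Γ(A) e^{iφ(ξ)} Γ(A)⁻¹ = e^{iφ(Aξ)}` (`isExpI_conj_secondQuant_iff`). As `V(Λ)` maps
  the test functions supported in `S` onto those supported in `Λ·S` (`pull_mem_testFun_iff`),
  conjugation by `V(Λ)` maps `E_R(S)` onto `E_R(Λ·S)`; it is compatible with commutants, and
  `Λ·O' = (Λ·O)'` since `Λ` acts bijectively on `B`.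
-/

open Filter Topology

namespace DeSitter

/-! ### Commutants -/

section Commutant

lemma exists_vonNeumannAlgebra_eq_centralizer {H : Type*} [NormedAddCommGroup H]
    [InnerProductSpace ℂ H] [CompleteSpace H] (S : Set (H →L[ℂ] H)) (hS : ∀ A ∈ S, star A ∈ S) :
    ∃ M : VonNeumannAlgebra H, (M : Set (H →L[ℂ] H)) = S.centralizer := by
  have hS' : S ∪ star S = S :=
    Set.union_eq_left.2 fun A hA => by simpa using hS _ (Set.mem_star.1 hA)
  have h : (StarSubalgebra.centralizer ℂ S : Set (H →L[ℂ] H)) = S.centralizer := by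
    rw [StarSubalgebra.coe_centralizer, hS']
  refine ⟨⟨StarSubalgebra.centralizer ℂ S, ?_⟩, h⟩
  change Set.centralizer (Set.centralizer (StarSubalgebra.centralizer ℂ S : Set (H →L[ℂ] H))) =
    (StarSubalgebra.centralizer ℂ S : Set (H →L[ℂ] H))
  rw [h, Set.centralizer_centralizer_centralizer]

lemma image_centralizer {M M' F : Type*} [Mul M] [Mul M'] [EquivLike F M M']
    [MulEquivClass F M M'] (e : F) (S : Set M) :
    e '' S.centralizer = (e '' S).centralizer := by
  ext x
  constructor
  · rintro ⟨a, ha, rfl⟩ _ ⟨b, hb, rfl⟩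
    rw [← map_mul, ← map_mul, ha b hb]
  · intro hx
    obtain ⟨a, rfl⟩ := EquivLike.surjective e x
    refine ⟨a, fun b hb => EquivLike.injective e ?_, rfl⟩
    rw [map_mul, map_mul, hx _ ⟨b, hb, rfl⟩]

lemma conjStarAlgEquiv_mem_unitary {H : Type*} [NormedAddCommGroup H] [InnerProductSpace ℂ H]
    [CompleteSpace H] (X : H ≃ₗᵢ[ℂ] H) {U : H →L[ℂ] H} (hU : U ∈ unitary (H →L[ℂ] H)) :
    X.conjStarAlgEquiv U ∈ unitary (H →L[ℂ] H) :=
  Unitary.map_mem X.conjStarAlgEquiv hU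

end Commutant

/-! ### Exponentials of field operators -/

section Exponential

variable {E : Type} [NormedAddCommGroup E] [InnerProductSpace ℂ E] {N : ℕ}
variable {R : ℝ → (HTensor E E ≃ₗᵢ[ℂ] HTensor E E)} {θ : Fin N → ℝ}

/-- The adjoint of `e^{iA}` is `e^{-iA}`: reverse the time in the one-parameter group. -/
lemma IsExpI.star {A : (m : ℕ) → Sym R θ m → Fock R θ} {W : Fock R θ →L[ℂ] Fock R θ}
    (h : IsExpI R θ A W) : IsExpI R θ (fun m Ψ => -A m Ψ) (star W) := by
  obtain ⟨U, h0, hadd, hU, hc, hd, h1⟩ := h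
  refine ⟨fun t => U (-t), by simp only [neg_zero, h0], fun t u => by simp only [neg_add, hadd],
    fun t => hU _, fun v => (hc v).comp continuous_neg, fun m Ψ => ?_, ?_⟩
  · have hneg : Tendsto (fun t : ℝ => -t) (𝓝[≠] 0) (𝓝[≠] 0) := by
      refine tendsto_nhdsWithin_iff.2 ⟨?_, ?_⟩
      · simpa using (continuous_neg.tendsto (0 : ℝ)).mono_left nhdsWithin_le_nhds
      · filter_upwards [self_mem_nhdsWithin] with t ht
        simpa using ht
    rw [smul_neg]
    refine ((hd m Ψ).comp hneg).neg.congr fun t => ?_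
    simp only [Function.comp_apply, inv_neg, Complex.ofReal_neg, neg_smul, neg_neg]
  · have h2 : U (-1) * U 1 = 1 := by rw [← hadd, neg_add_cancel, h0]
    rw [← h1]
    calc U (-1) = U (-1) * (U 1 * Star.star (U 1)) := by
          rw [Unitary.mul_star_self_of_mem (hU 1), mul_one]
      _ = Star.star (U 1) := by rw [← mul_assoc, h2, one_mul]

/-- Unitary covariance of `A ↦ e^{iA}` for a unitary operator `X` that preserves the particle
number. -/
lemma IsExpI.conj {A A' : (m : ℕ) → Sym R θ m → Fock R θ} {W : Fock R θ →L[ℂ] Fock R θ}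
    (h : IsExpI R θ A W) (X : Fock R θ ≃ₗᵢ[ℂ] Fock R θ) (Y : (m : ℕ) → Sym R θ m ≃ Sym R θ m)
    (hX : ∀ m Ψ, X (single R θ m Ψ) = single R θ m (Y m Ψ))
    (hA : ∀ m Ψ, X (A m Ψ) = A' m (Y m Ψ)) : IsExpI R θ A' (X.conjStarAlgEquiv W) := by
  obtain ⟨U, h0, hadd, hU, hc, hd, h1⟩ := h
  refine ⟨fun t => X.conjStarAlgEquiv (U t), (congrArg _ h0).trans (map_one X.conjStarAlgEquiv),
    fun t u => (congrArg _ (hadd t u)).trans (map_mul X.conjStarAlgEquiv _ _),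
    fun t => conjStarAlgEquiv_mem_unitary X (hU t),
    fun v => X.continuous.comp (hc _), fun m Ψ => ?_, congrArg _ h1⟩
  obtain ⟨Φ, rfl⟩ := (Y m).surjective Ψ
  rw [← hA, ← map_smul]
  refine ((X.continuous.tendsto _).comp (hd m Φ)).congr fun t => ?_
  rw [Function.comp_apply, map_smul, map_sub, ← hX,
    LinearIsometryEquiv.conjStarAlgEquiv_apply_apply, X.symm_apply_apply]

lemma tensL_neg (x : E) (m : ℕ) (y : Pow E m) : tensL (-x) m y = -tensL x m y := by
  change incl E (Pow E m) ((-x) ⊗ₜ[ℂ] y) = -incl E (Pow E m) (x ⊗ₜ[ℂ] y)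
  rw [TensorProduct.neg_tmul, map_neg]

lemma creation_neg (ξ : H1 E N) (m : ℕ) : creation R θ (-ξ) m = -creation R θ ξ m := by
  have h : tensH (-ξ) m = -tensH ξ m := by
    ext Ψ J
    exact tensL_neg _ _ _
  rw [creation, creation, h, ContinuousLinearMap.neg_comp, ContinuousLinearMap.comp_neg, smul_neg]

lemma annihilation_neg (ξ : H1 E N) (m : ℕ) :
    annihilation R θ (-ξ) m = -annihilation R θ ξ m := by
  ext1 Ψ
  refine ext_inner_left ℂ fun Φ => ?_
  rw [annihilation, annihilation, creation_neg, neg_apply, inner_neg_right,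
    ContinuousLinearMap.adjoint_inner_right, ContinuousLinearMap.adjoint_inner_right,
    neg_apply, inner_neg_left]

lemma single_neg (m : ℕ) (Ψ : Sym R θ m) : single R θ m (-Ψ) = -single R θ m Ψ :=
  lp.single_neg (E := fun m : ℕ => Sym R θ m) 2 m Ψ

lemma field_neg (ξ : H1 E N) (m : ℕ) (Ψ : Sym R θ m) :
    field R θ (-ξ) m Ψ = -field R θ ξ m Ψ := by
  cases m with
  | zero => simp only [field, creation_neg, neg_apply, single_neg]
  | succ m =>
    simp only [field, annihilation_neg, creation_neg, neg_apply, single_neg, neg_add]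

/-- The exponentiated fields of a symmetric set of one-particle vectors form a self-adjoint set. -/
lemma star_mem_expField {S : Set (H1 E N)} (hS : ∀ ξ ∈ S, -ξ ∈ S)
    {W : Fock R θ →L[ℂ] Fock R θ} (hW : ∃ ξ ∈ S, IsExpI R θ (field R θ ξ) W) :
    ∃ ξ ∈ S, IsExpI R θ (field R θ ξ) (star W) := by
  obtain ⟨ξ, hξ, h⟩ := hW
  refine ⟨-ξ, hS ξ hξ, ?_⟩
  have e : field R θ (-ξ) = fun m Ψ => -field R θ ξ m Ψ := by
    funext m Ψ
    exact field_neg ξ m Ψ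
  rw [e]
  exact h.star

lemma star_mem_fieldAlg {S : Set (H1 E N)} (hS : ∀ ξ ∈ S, -ξ ∈ S)
    {W : Fock R θ →L[ℂ] Fock R θ} (hW : W ∈ fieldAlg R θ S) : star W ∈ fieldAlg R θ S :=
  Set.star_mem_centralizer' (fun _ hA =>
    Set.star_mem_centralizer' (fun _ hB => star_mem_expField hS hB) hA) hW

lemma fieldAlg_mono {S T : Set (H1 E N)} (h : S ⊆ T) : fieldAlg R θ S ⊆ fieldAlg R θ T :=
  Set.centralizer_subset <| Set.centralizer_subset fun _ ⟨ξ, hξ, hW⟩ => ⟨ξ, h hξ, hW⟩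

end Exponential

/-! ### Covariance of the field operators under second quantization -/

section Covariance

variable {E : Type} [NormedAddCommGroup E] [InnerProductSpace ℂ E] {N : ℕ}

variable (N) in
/-- The operator `1 ⊗ A` on the one-particle space `ℂ^N ⊗ E`. -/
noncomputable def oneMap (A : E ≃ₗᵢ[ℂ] E) : H1 E N ≃ₗᵢ[ℂ] H1 E N :=
  LinearIsometryEquiv.piLpCongrRight 2 fun _ => A

variable (R : ℝ → (HTensor E E ≃ₗᵢ[ℂ] HTensor E E)) (θ : Fin N → ℝ)
variable (A : E ≃ₗᵢ[ℂ] E) (hA : ∀ t x, R t (hmap A A x) = hmap A A (R t x))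

lemma powMapH_tensH (ξ : H1 E N) (m : ℕ) (Ψ : HPow E N m) :
    powMapH N A (m + 1) (tensH ξ m Ψ) = tensH (oneMap N A ξ) m (powMapH N A m Ψ) := by
  ext J
  exact powMap_tensL A (ξ (J 0)) m (Ψ (Fin.tail J))

lemma symMap_projection (m : ℕ) (Ψ : HPow E N m) :
    symMap R θ A hA m ((Sym R θ m).orthogonalProjectionOnto Ψ) =
      (Sym R θ m).orthogonalProjectionOnto (powMapH N A m Ψ) := by
  refine ext_inner_left ℂ fun Φ => ?_
  obtain ⟨Φ, rfl⟩ := (symMap R θ A hA m).surjective Φ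
  rw [LinearIsometryEquiv.inner_map_map, Submodule.inner_orthogonalProjectionOnto_eq_of_mem_left,
    Submodule.inner_orthogonalProjectionOnto_eq_of_mem_left]
  exact ((powMapH N A m).inner_map_map _ _).symm

lemma symMap_creation (ξ : H1 E N) (m : ℕ) (Ψ : Sym R θ m) :
    symMap R θ A hA (m + 1) (creation R θ ξ m Ψ) =
      creation R θ (oneMap N A ξ) m (symMap R θ A hA m Ψ) := by
  change symMap R θ A hA (m + 1) (((Real.sqrt (m + 1) : ℝ) : ℂ) •
      (Sym R θ (m + 1)).orthogonalProjectionOnto (tensH ξ m Ψ)) =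
    ((Real.sqrt (m + 1) : ℝ) : ℂ) • (Sym R θ (m + 1)).orthogonalProjectionOnto
      (tensH (oneMap N A ξ) m (powMapH N A m Ψ))
  rw [map_smul, symMap_projection, powMapH_tensH]

lemma symMap_annihilation (ξ : H1 E N) (m : ℕ) (Ψ : Sym R θ (m + 1)) :
    symMap R θ A hA m (annihilation R θ ξ m Ψ) =
      annihilation R θ (oneMap N A ξ) m (symMap R θ A hA (m + 1) Ψ) := by
  refine ext_inner_left ℂ fun Φ => ?_
  obtain ⟨Φ, rfl⟩ := (symMap R θ A hA m).surjective Φ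
  rw [annihilation, annihilation, LinearIsometryEquiv.inner_map_map,
    ContinuousLinearMap.adjoint_inner_right, ContinuousLinearMap.adjoint_inner_right,
    ← symMap_creation, LinearIsometryEquiv.inner_map_map]

lemma secondQuant_single (m : ℕ) (Ψ : Sym R θ m) :
    secondQuant R θ A hA (single R θ m Ψ) = single R θ m (symMap R θ A hA m Ψ) := by
  refine lp.ext (funext fun k => ?_)
  change symMap R θ A hA k ((lp.single 2 m Ψ : Fock R θ) k) =
    (lp.single 2 m (symMap R θ A hA m Ψ) : Fock R θ) k
  rw [lp.coeFn_single, lp.coeFn_single]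
  exact (Pi.apply_single (fun k => symMap R θ A hA k) (fun k => map_zero _) m Ψ k)

lemma secondQuant_field (ξ : H1 E N) (m : ℕ) (Ψ : Sym R θ m) :
    secondQuant R θ A hA (field R θ ξ m Ψ) =
      field R θ (oneMap N A ξ) m (symMap R θ A hA m Ψ) := by
  cases m with
  | zero => rw [field, field, secondQuant_single, symMap_creation]
  | succ m =>
    rw [field, field, map_add, secondQuant_single, secondQuant_single, symMap_creation,
      symMap_annihilation]

variable {R θ A} in
/-- Second quantization transforms the exponentiated fields by
`Γ(A) e^{iφ(ξ)} Γ(A)⁻¹ = e^{iφ(Aξ)}`. -/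
lemma isExpI_conj_secondQuant_iff {ξ : H1 E N} {W : Fock R θ →L[ℂ] Fock R θ} :
    IsExpI R θ (field R θ (oneMap N A ξ)) ((secondQuant R θ A hA).conjStarAlgEquiv W) ↔
      IsExpI R θ (field R θ ξ) W := by
  refine ⟨fun h => ?_, fun h => h.conj _ (fun m => (symMap R θ A hA m).toEquiv)
    (secondQuant_single R θ A hA) (secondQuant_field R θ A hA ξ)⟩
  have h' := h.conj (A' := field R θ ξ) (secondQuant R θ A hA).symm
    (fun m => (symMap R θ A hA m).symm.toEquiv) (fun m Ψ => ?_) (fun m Ψ => ?_)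
  · rw [← LinearIsometryEquiv.symm_conjStarAlgEquiv] at h'
    rwa [StarAlgEquiv.symm_apply_apply] at h'
  · obtain ⟨Φ, rfl⟩ := (symMap R θ A hA m).surjective Ψ
    rw [← secondQuant_single, LinearIsometryEquiv.symm_apply_apply]
    exact congrArg _ ((symMap R θ A hA m).symm_apply_apply Φ).symm
  · obtain ⟨Φ, rfl⟩ := (symMap R θ A hA m).surjective Ψ
    rw [← secondQuant_field, LinearIsometryEquiv.symm_apply_apply]
    exact congrArg _ ((symMap R θ A hA m).symm_apply_apply Φ).symm

end Covariance

/-! ### The conformal action and the supports of test functions -/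

section Conformal

variable {n : ℕ}

lemma ray_coneDil (r : ℝ) (hr : 0 < r) (P : cone n) : ray (coneDil r hr P) = ray P := by
  have h : r * (P : Mink n).1 - r * (P : Mink n).2.2 =
      r * ((P : Mink n).1 - (P : Mink n).2.2) := by ring
  simp only [ray, coneDil, Prod.smul_fst, Prod.smul_snd, smul_eq_mul, h, smul_smul,
    mul_right_inj' hr.ne']
  congr 3
  rw [mul_inv, mul_right_comm, inv_mul_cancel₀ hr.ne', one_mul]

lemma exists_eq_coneDil_rep (P : cone n) : ∃ r, ∃ hr : 0 < r, P = coneDil r hr (rep (ray P)) := by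
  by_cases h : (P : Mink n).1 = (P : Mink n).2.2
  · refine ⟨_, P.2.2, ?_⟩
    rw [ray, if_pos h]
    exact eq_of_minus_eq_zero P (sub_eq_zero.2 h)
  · have h' : 0 < minus (P : Mink n) := lt_of_le_of_ne (minus_nonneg P) (Ne.symm (sub_ne_zero.2 h))
    refine ⟨_, h', ?_⟩
    rw [ray, if_neg h]
    exact eq_of_minus_ne_zero P h'

lemma ray_rep (b : Base n) : ray (rep b) = b := by
  induction b using OnePoint.rec with
  | infty => exact if_pos rfl
  | coe x =>
    change ray (flat x) = _
    have h : ((flat x : Mink n).1 - (flat x : Mink n).2.2) = 1 := minus_flat x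
    rw [ray, if_neg (fun e => by rw [e, sub_self] at h; exact zero_ne_one h), h, inv_one, one_smul]
    rfl

/-- The projection of the light cone onto its space of rays is equivariant. -/
lemma ray_coneAct (Λ : lorentz n) (P : cone n) : ray (coneAct Λ P) = conf Λ (ray P) := by
  obtain ⟨r, hr, h⟩ := exists_eq_coneDil_rep P
  conv_lhs => rw [h]
  rw [coneAct_dil, ray_coneDil, conf]

lemma conf_inv_conf (Λ : lorentz n) (b : Base n) : conf Λ⁻¹ (conf Λ b) = b := by
  rw [conf.eq_1 Λ b, ← ray_coneAct, coneAct_inv, ray_rep]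

lemma conf_conf_inv (Λ : lorentz n) (b : Base n) : conf Λ (conf Λ⁻¹ b) = b := by
  rw [conf.eq_1 Λ⁻¹ b, ← ray_coneAct, coneAct_inv', ray_rep]

lemma conf_bijective (Λ : lorentz n) : Function.Bijective (conf Λ) :=
  ⟨Function.LeftInverse.injective (conf_inv_conf Λ),
    Function.RightInverse.surjective (conf_conf_inv Λ)⟩

lemma image_conf_compl (Λ : lorentz n) (O : Set (Base n)) : conf Λ '' Oᶜ = (conf Λ '' O)ᶜ :=
  Set.image_compl_eq (conf_bijective Λ)

/-- The action of a Lorentz transformation on the light cone, as a homeomorphism. -/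
def coneHomeo (Λ : lorentz n) : cone n ≃ₜ cone n where
  toFun := coneAct Λ
  invFun := coneAct Λ⁻¹
  left_inv := coneAct_inv Λ
  right_inv := coneAct_inv' Λ
  continuous_toFun := (Λ.1.continuous.comp continuous_subtype_val).subtype_mk _
  continuous_invFun := (Λ⁻¹.1.continuous.comp continuous_subtype_val).subtype_mk _

variable {s : Param n}

lemma tsupport_pull (Λ : lorentz n) (f : Wave n s) :
    tsupport (pull Λ f : Wave n s).1 = coneHomeo Λ⁻¹ ⁻¹' tsupport f.1 :=
  tsupport_comp_eq_preimage f.1 (coneHomeo Λ⁻¹)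

/-- A Lorentz transformation maps the test functions supported in `O` onto those supported in
`Λ·O`. -/
lemma pull_mem_testFun_iff (Λ : lorentz n) (f : Wave n s) (O : Set (Base n)) :
    pull Λ f ∈ testFun s (conf Λ '' O) ↔ f ∈ testFun s O := by
  refine and_congr ⟨fun h P => ?_, fun h P => h _⟩ ?_
  · have := h (coneAct Λ P)
    change (f.1 (coneAct Λ⁻¹ (coneAct Λ P))).im = 0 at this
    rwa [coneAct_inv] at this
  · rw [tsupport_pull]
    constructor
    · intro h P hP
      have h1 : ray (coneAct Λ P) ∈ conf Λ '' O := h (by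
        change coneAct Λ⁻¹ (coneAct Λ P) ∈ tsupport f.1
        rwa [coneAct_inv])
      rw [ray_coneAct] at h1
      exact (conf_bijective Λ).1.mem_set_image.1 h1
    · intro h P hP
      refine ⟨ray (coneAct Λ⁻¹ P), h hP, ?_⟩
      rw [← ray_coneAct, coneAct_inv']

lemma V_toK (Λ : lorentz n) (f : Wave n s) : V Λ (toK f) = toK (pull Λ f) :=
  LinearEquiv.extendOfIsometry_eq _ toK toK _ _ _ f

lemma oneMap_vec {N : ℕ} (Λ : lorentz n) (j : Fin N) (f : Wave n s) :
    oneMap N (V Λ) (vec j f) = vec j (pull Λ f) := by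
  ext k
  change V Λ ((Pi.single j (toK f) : Fin N → K n s) k) =
    (Pi.single j (toK (pull Λ f)) : Fin N → K n s) k
  rw [← V_toK]
  exact Pi.apply_single (fun _ => V Λ) (fun _ => map_zero _) j (toK f) k

lemma neg_mem_testVec {N : ℕ} {O : Set (Base n)} (ξ : H1 (K n s) N)
    (hξ : ∃ (j : Fin N) (f : Wave n s), f ∈ testFun s O ∧ ξ = vec j f) :
    ∃ (j : Fin N) (f : Wave n s), f ∈ testFun s O ∧ -ξ = vec j f := by
  obtain ⟨j, f, ⟨him, hsupp⟩, rfl⟩ := hξ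
  refine ⟨j, -f, ⟨fun P => ?_, ?_⟩, ?_⟩
  · change (-(f.1 P)).im = 0
    rw [Complex.neg_im, him P, neg_zero]
  · change tsupport (-f.1) ⊆ _
    rwa [tsupport, Function.support_neg]
  · rw [vec, vec, map_neg, Pi.single_neg, WithLp.toLp_neg]

end Conformal

/-! ### The net of algebras -/

section Algebras

variable {n : ℕ} {s : Param n} (R : InvariantYBFunction n s) {N : ℕ} (θ : Fin N → ℝ)

lemma algE_mono {O₁ O₂ : Set (Base n)} (h : O₁ ⊆ O₂) : algE R θ O₁ ⊆ algE R θ O₂ :=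
  fieldAlg_mono fun _ ⟨j, f, hf, hξ⟩ =>
    ⟨j, f, ⟨hf.1, hf.2.trans (Set.preimage_mono h)⟩, hξ⟩

lemma star_mem_algE {O : Set (Base n)} {W : HR R θ →L[ℂ] HR R θ} (hW : W ∈ algE R θ O) :
    star W ∈ algE R θ O :=
  star_mem_fieldAlg neg_mem_testVec hW

lemma exists_vonNeumannAlgebra_eq_algF (O : Set (Base n)) :
    ∃ M : VonNeumannAlgebra (HR R θ), (M : Set (HR R θ →L[ℂ] HR R θ)) = algF R θ O := by
  have h : algF R θ O = ((algE R θ O).centralizer ∪ algE R θ Oᶜ).centralizer := by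
    rw [Set.centralizer_union, algF, algE, fieldAlg, Set.centralizer_centralizer_centralizer]
  rw [h]
  refine exists_vonNeumannAlgebra_eq_centralizer _ ?_
  rintro A (hA | hA)
  · exact Or.inl (Set.star_mem_centralizer' (fun _ hB => star_mem_algE R θ hB) hA)
  · exact Or.inr (star_mem_algE R θ hA)

lemma algF_mono {O₁ O₂ : Set (Base n)} (h : O₁ ⊆ O₂) : algF R θ O₁ ⊆ algF R θ O₂ :=
  Set.inter_subset_inter (algE_mono R θ h)
    (Set.centralizer_subset (algE_mono R θ (Set.compl_subset_compl.2 h)))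

lemma algF_commute {O₁ O₂ : Set (Base n)} (h : Disjoint O₁ O₂) {A B : HR R θ →L[ℂ] HR R θ}
    (hA : A ∈ algF R θ O₁) (hB : B ∈ algF R θ O₂) : A * B = B * A :=
  hB.2 A (algE_mono R θ h.subset_compl_right hA.1)

/-- Conjugation by `V(Λ)` maps the generators of `E_R(O)` onto those of `E_R(Λ·O)`. -/
lemma conj_mem_expField_iff (Λ : lorentz n) {O : Set (Base n)} {W : HR R θ →L[ℂ] HR R θ} :
    (∃ ξ ∈ {ξ | ∃ (j : Fin N) (f : Wave n s), f ∈ testFun s (conf Λ '' O) ∧ ξ = vec j f},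
      IsExpI R.toFun θ (field R.toFun θ ξ) ((VR R θ Λ).conjStarAlgEquiv W)) ↔
    ∃ ξ ∈ {ξ | ∃ (j : Fin N) (f : Wave n s), f ∈ testFun s O ∧ ξ = vec j f},
      IsExpI R.toFun θ (field R.toFun θ ξ) W := by
  have key : ∀ (j : Fin N) (f : Wave n s), IsExpI R.toFun θ (field R.toFun θ (vec j (pull Λ f)))
      ((VR R θ Λ).conjStarAlgEquiv W) ↔ IsExpI R.toFun θ (field R.toFun θ (vec j f)) W := by
    intro j f
    rw [← oneMap_vec]
    exact isExpI_conj_secondQuant_iff (fun t x => R.invariant t Λ x)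
  constructor
  · rintro ⟨_, ⟨j, f, hf, rfl⟩, h⟩
    obtain ⟨g, rfl⟩ := (pull Λ).surjective f
    exact ⟨vec j g, ⟨j, g, (pull_mem_testFun_iff Λ g O).1 hf, rfl⟩, (key j g).1 h⟩
  · rintro ⟨_, ⟨j, f, hf, rfl⟩, h⟩
    exact ⟨vec j (pull Λ f), ⟨j, pull Λ f, (pull_mem_testFun_iff Λ f O).2 hf, rfl⟩,
      (key j f).2 h⟩

lemma image_algE (Λ : lorentz n) (O : Set (Base n)) :
    (VR R θ Λ).conjStarAlgEquiv '' algE R θ O = algE R θ (conf Λ '' O) := by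
  rw [algE, fieldAlg, image_centralizer, image_centralizer, algE, fieldAlg]
  congr 2
  ext W
  obtain ⟨W, rfl⟩ := EquivLike.surjective (VR R θ Λ).conjStarAlgEquiv W
  rw [(EquivLike.injective (VR R θ Λ).conjStarAlgEquiv).mem_set_image]
  exact (conj_mem_expField_iff R θ Λ).symm

lemma image_algF (Λ : lorentz n) (O : Set (Base n)) :
    (VR R θ Λ).conjStarAlgEquiv '' algF R θ O = algF R θ (conf Λ '' O) := by
  rw [algF, Set.image_inter (EquivLike.injective (VR R θ Λ).conjStarAlgEquiv),
    image_centralizer, image_algE, image_algE, image_conf_compl, algF]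

end Algebras

end DeSitter

theorem mainTheorem8 (d : ℕ) (hd : 2 ≤ d) (s : Param (d - 1)) (R : InvariantYBFunction (d - 1) s)
    (N : ℕ) (θ : Fin N → ℝ) :
    -- each `F_R(O)` is a von Neumann algebra on the `R`-symmetric Fock space
    (∀ O : Set (Base (d - 1)), IsOpen O →
      ∃ M : VonNeumannAlgebra (HR R θ), (M : Set (HR R θ →L[ℂ] HR R θ)) = algF R θ O) ∧
    -- `O ↦ F_R(O)` is a net
    (∀ O₁ O₂ : Set (Base (d - 1)), IsOpen O₁ → IsOpen O₂ → O₁ ⊆ O₂ →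
      algF R θ O₁ ⊆ algF R θ O₂) ∧
    -- the net is local
    (∀ O₁ O₂ : Set (Base (d - 1)), IsOpen O₁ → IsOpen O₂ → Disjoint O₁ O₂ →
      ∀ A ∈ algF R θ O₁, ∀ B ∈ algF R θ O₂, A * B = B * A) ∧
    -- the net is covariant: `V(Λ) F_R(O) V(Λ)⁻¹ = F_R(Λ·O)`
    (∀ (Λ : lorentz (d - 1)) (O : Set (Base (d - 1))), IsOpen O →
      (fun A : HR R θ →L[ℂ] HR R θ => (VR R θ Λ : HR R θ →L[ℂ] HR R θ) * A *
        ((VR R θ Λ).symm : HR R θ →L[ℂ] HR R θ)) '' algF R θ O = algF R θ (conf Λ '' O)) := by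
  exact ⟨fun O _ => exists_vonNeumannAlgebra_eq_algF R θ O, fun O₁ O₂ _ _ h => algF_mono R θ h,
    fun O₁ O₂ _ _ h A hA B hB => algF_commute R θ h hA hB, fun Λ O _ => image_algF R θ Λ O⟩
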